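/- Notation. For $X\in\mathbb R^{m\times n}$ with singular values $\sigma_1\ge\sigma_2\ge\dots$ and $0<p<\infty$, let $\|X\|_{S_p}=\big(\sum_{j\le\min(m,n)}\sigma_j^p\big)^{1/p}$, and let $\|X\|_{S_\infty}$ be the operator norm. For $z\in\mathbb R^L$ let $\|z\|_q=(\sum_j|z_j|^q)^{1/q}$. Let $\mathcal A:\mathbb R^{m\times n}\to\mathbb R^L$ be linear, with adjoint $\mathcal A^*$ with respect to the inner products $\langle X,Y\rangle=\operatorname{trace}(X^TY)$ and the standard one on $\mathbb R^L$. Put $$\mathcal B^{\ell_q}(\eta_1)=\{z:\|z\|_q/L\le\eta_1\},\qquad \mathcal B^{DS}(\eta_2)=\{z:\|\mathcal A^*(z)\|_{S_\infty}\le\eta_2\}.$$ $\mathcal A$ satisfies $\ell_q$-RUB of order $t$ with constants $C_1,C_2$ if $C_1\|X\|_{S_2}^q\le\|\mathcal A(X)\|_q^q/L\le C_2\|X\|_{S_2}^q$ for all nonzero $X$ of rank at most $t$. $X_{\max(r)}$ denotes a best approximation (in Frobenius norm) of $X$ by a matrix of rank at most $r$, and $X_{-\max(r)}=X-X_{\max(r)}$.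 Theorem. Let $r$ be a positive integer, $0<p\le q\le1$, let $k$ be real with $kr$ a positive integer, and let $\mathcal A$ satisfy $\ell_q$-RUB of order $(k+1)r$ with constants $C_1>0$ and $C_2$. Put $$\kappa=(1/k)^{(1/p-1/2)q},\qquad \rho_1=C_1-C_2\kappa,\qquad \rho_2=C_1-C_2\,2^{q/p-1}\kappa .$$ Let $b=\mathcal A(X)+z$ with $z\in\mathcal B$, and let $\hat X$ be a minimizer of $\|Y\|_{S_p}^p$ over all $Y\in\mathbb R^{m\times n}$ with $b-\mathcal A(Y)\in\mathcal B$. (1) Suppose $k>1$, $C_2/C_1<k^{(1/p-1/2)q}$ and $\operatorname{rank}X\le r$. If $\mathcal B=\mathcal B^{\ell_q}(\eta_1)\cap\mathcal B^{DS}(\eta_2)$, then $$\|\hat X-X\|_{S_2}^q\le(\kappa+1)\frac1{\rho_1L^q}\min\Big\{\frac{2}{L^{1-2q}}\eta_1^q,\ \frac{2^{q/p+q}}{\rho_1}r^{(1/p-1/2)q}\eta_2^q\Big\};$$ if $\mathcal B=\mathcal B^{\ell_q}(\eta_1)$, then $\|\hat X-X\|_{S_2}^q\le\frac{2}{\rho_1L^{1-q}}(\kappa+1)\eta_1^q$;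 if $\mathcal B=\mathcal B^{DS}(\eta_2)$, then $\|\hat X-X\|_{S_2}^q\le\frac{2^{q/p+q}r^{(1/p-1/2)q}}{L^q\rho_1^2}(\kappa+1)\eta_2^q$. (2) Suppose $k>2^{\frac{2(q-p)}{q(2-p)}}$ and $C_2/C_1<2^{1-q/p}k^{(1/p-1/2)q}$, and let $X$ be arbitrary. Put $$E_1=\Big(\frac{C_22^{2q/p-1}}{\rho_2}\kappa+1\Big)\big(2^{2q/p-1}\kappa+1\big)\Big(\frac{\|X_{-\max(r)}\|_{S_p}}{r^{1/p-1/2}}\Big)^q+\frac{2}{\rho_2L^{1-q}}\big(2^{q/p-1}\kappa+1\big)\eta_1^q,$$ $$E_2=\Big(\frac{C_22^{2q/p}}{\rho_2}\kappa+\frac32\Big)\big(2^{2q/p-1}\kappa+1\big)\Big(\frac{\|X_{-\max(r)}\|_{S_p}}{r^{1/p-1/2}}\Big)^q+\frac{2^{2q/p+q+1}r^{(1/p-1/2)q}}{L^q\rho_2^2}\big(2^{q/p-1}\kappa+1\big)\eta_2^q .$$ If $\mathcal B=\mathcal B^{\ell_q}(\eta_1)\cap\mathcal B^{DS}(\eta_2)$,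 then $\|\hat X-X\|_{S_2}^q\le\min\{E_1,E_2\}$; if $\mathcal B=\mathcal B^{\ell_q}(\eta_1)$, then $\|\hat X-X\|_{S_2}^q\le E_1$; if $\mathcal B=\mathcal B^{DS}(\eta_2)$, then $\|\hat X-X\|_{S_2}^q\le E_2$. -/

import Mathlib

namespace MatrixRecovery

/-- The `j`-th largest singular value `σ_j(X)` of a real `m × n` matrix (indexed from `0`). -/
noncomputable def singVal {m n : ℕ} (X : Matrix (Fin m) (Fin n) ℝ) (j : ℕ) : ℝ :=
  (Matrix.toEuclideanLin X).singularValues j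

/-- The Schatten `p`-(quasi-)norm `(∑_{j ≤ min(m,n)} σ_j(X)^p)^{1/p}`, for finite `p > 0`. -/
noncomputable def schattenNorm {m n : ℕ} (p : ℝ) (X : Matrix (Fin m) (Fin n) ℝ) : ℝ :=
  (∑ j ∈ Finset.range (min m n), singVal X j ^ p) ^ (1 / p)

/-- The Schatten `∞`-norm: the operator norm with respect to the Euclidean norms. -/
noncomputable def schattenInfNorm {m n : ℕ} (X : Matrix (Fin m) (Fin n) ℝ) : ℝ :=
  ‖LinearMap.toContinuousLinearMap (Matrix.toEuclideanLin X)‖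

/-- The `ℓ_q` (quasi-)norm of a vector, for finite `q > 0`. -/
noncomputable def lqNorm {L : ℕ} (q : ℝ) (z : Fin L → ℝ) : ℝ :=
  (∑ j, |z j| ^ q) ^ (1 / q)

/-- The adjoint `𝒜*` of a linear map `𝒜 : ℝ^{m×n} → ℝ^L` with respect to the inner products
`⟨X, Y⟩ = trace (Xᵀ Y)` and `⟨z, w⟩ = ∑ z_l w_l`; see `trace_transpose_mul_adj`. -/
noncomputable def adj {m n L : ℕ} (A : Matrix (Fin m) (Fin n) ℝ →ₗ[ℝ] (Fin L → ℝ))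
    (z : Fin L → ℝ) : Matrix (Fin m) (Fin n) ℝ :=
  Matrix.of fun i j => ∑ l, A (Matrix.single i j 1) l * z l

theorem trace_transpose_mul_adj {m n L : ℕ} (A : Matrix (Fin m) (Fin n) ℝ →ₗ[ℝ] (Fin L → ℝ))
    (X : Matrix (Fin m) (Fin n) ℝ) (z : Fin L → ℝ) :
    (X.transpose * adj A z).trace = ∑ l, A X l * z l := by
  have hX : A X = ∑ i, ∑ j, X i j • A (Matrix.single i j 1) := by
    conv_lhs => rw [Matrix.matrix_eq_sum_single X]
    simp only [map_sum]
    refine Finset.sum_congr rfl fun i _ => Finset.sum_congr rfl fun j _ => ?_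
    rw [← map_smul, Matrix.smul_single, smul_eq_mul, mul_one]
  have h1 : ∑ l, A X l * z l = ∑ l, ∑ i, ∑ j, X i j * (A (Matrix.single i j 1) l * z l) := by
    refine Finset.sum_congr rfl fun l _ => ?_
    rw [hX]
    simp only [Finset.sum_apply, Pi.smul_apply, smul_eq_mul, Finset.sum_mul, mul_assoc]
  rw [h1, Finset.sum_comm]
  simp only [Matrix.trace, Matrix.diag, Matrix.mul_apply, Matrix.transpose_apply, adj,
    Matrix.of_apply, Finset.mul_sum]
  rw [Finset.sum_comm]
  refine Finset.sum_congr rfl fun i _ => ?_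
  rw [Finset.sum_comm]

/-- `ℓ_q`-restricted uniform boundedness of order `r` with constants `C₁`, `C₂`. -/
def LqRUB {m n L : ℕ} (A : Matrix (Fin m) (Fin n) ℝ →ₗ[ℝ] (Fin L → ℝ)) (q : ℝ) (r : ℕ)
    (C₁ C₂ : ℝ) : Prop :=
  ∀ X : Matrix (Fin m) (Fin n) ℝ, X ≠ 0 → X.rank ≤ r →
    C₁ * schattenNorm 2 X ^ q ≤ lqNorm q (A X) ^ q / L ∧
      lqNorm q (A X) ^ q / L ≤ C₂ * schattenNorm 2 X ^ q

/-- The noise set `ℬ^{ℓ_q}(η) = {z : ‖z‖_q / L ≤ η}`. -/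
def lqBall (L : ℕ) (q η : ℝ) : Set (Fin L → ℝ) :=
  {z | lqNorm q z / L ≤ η}

/-- The Dantzig selector noise set `ℬ^{DS}(η) = {z : ‖𝒜*(z)‖_{S_∞} ≤ η}`. -/
def dantzigBall {m n L : ℕ} (A : Matrix (Fin m) (Fin n) ℝ →ₗ[ℝ] (Fin L → ℝ)) (η : ℝ) :
    Set (Fin L → ℝ) :=
  {z | schattenInfNorm (adj A z) ≤ η}

/-- `Xhat` solves: minimize `‖Y‖_{S_p}^p` subject to `b - 𝒜(Y) ∈ B`. -/
def IsSchattenMinimizer {m n L : ℕ} (A : Matrix (Fin m) (Fin n) ℝ →ₗ[ℝ] (Fin L → ℝ)) (p : ℝ)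
    (b : Fin L → ℝ) (B : Set (Fin L → ℝ)) (Xhat : Matrix (Fin m) (Fin n) ℝ) : Prop :=
  b - A Xhat ∈ B ∧
    ∀ Y : Matrix (Fin m) (Fin n) ℝ, b - A Y ∈ B → schattenNorm p Xhat ^ p ≤ schattenNorm p Y ^ p

/-- `Y` is a best rank-`r` approximation of `X` (in Frobenius norm): it has rank at most `r` and is
at least as close to `X` as every other matrix of rank at most `r`. -/
def IsBestRankApprox {m n : ℕ} (r : ℕ) (X Y : Matrix (Fin m) (Fin n) ℝ) : Prop :=
  Y.rank ≤ r ∧ ∀ Z : Matrix (Fin m) (Fin n) ℝ, Z.rank ≤ r →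
    schattenNorm 2 (X - Y) ≤ schattenNorm 2 (X - Z)

end MatrixRecovery

namespace MatrixRecovery

open Module

/-! ### Courant–Fischer bounds for symmetric operators. -/

section Variational

variable {V : Type*} [NormedAddCommGroup V] [InnerProductSpace ℝ V]

/-! Write H for the error `Xhat - X`. The matrix-specific core is the inequality Σ|σ_i(T+A)^p -
σ_i(T)^p| ≤ Σσ_i(A)^p for p ≤ 1 (`sum_mul_singularValues_rpow_sub_le`). Applied to -H + Xhat = X, it
turns minimality of `Xhat` into a cone condition (`sum_tail_singularValues_rpow_le`): the p-tail of
H is at most its p-head plus twice the p-tail of X.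

That inequality is first proved with min(·, t) in place of the p-th power. The singular values of A
above t form a low-rank part, handled by Weyl interlacing at cost t each. Those below t are handled
by Mirsky's inequality at face value. The two costs add up to Σ min(σ_i(A), t). Since x^p is a
positive mixture over t of the functions min(x, t), integration finishes. Mirsky's inequality itself
comes from rank-one steps on the self-adjoint dilation, whose spectrum is symmetric with the
singular values as its upper part.

The SVD of H is then cut into a head of r + s components and blocks of length s = kr
(`exists_block_estimates`). The restricted bounds, from below on the head and from above on the
blocks, together with q-subadditivity give C₁a ≤ y + C₂S, where a is the q-th power of the head
norm, S the sum of those of the blocks, and y = ‖𝒜H‖_q^q / L. The cone condition bounds S by a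
multiple of a plus the tail of X, so a is controlled by y and that tail. For ℓ_q noise y is bounded
outright. For Dantzig noise, trace duality bounds y² by a multiple of a plus the tail, and the
factor a is cancelled or absorbed. -/

theorem exists_ne_zero_mem_inf_of_finrank_lt [FiniteDimensional ℝ V] (S K : Submodule ℝ V)
    (h : finrank ℝ V < finrank ℝ S + finrank ℝ K) : ∃ x ∈ S, x ∈ K ∧ x ≠ 0 := by
  have h1 := Submodule.finrank_add_le_finrank_add_finrank S K
  have h2 := Submodule.finrank_sup_add_finrank_inf_eq S K
  have h3 := Submodule.finrank_le (S ⊔ K)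
  have h4 : 0 < finrank ℝ (S ⊓ K : Submodule ℝ V) := by omega
  have h5 : S ⊓ K ≠ ⊥ := by
    rintro h
    rw [h, finrank_bot] at h4
    exact lt_irrefl _ h4
  obtain ⟨x, hx, hx0⟩ := Submodule.exists_mem_ne_zero_of_ne_bot h5
  exact ⟨x, hx.1, hx.2, hx0⟩

/-- The vectors whose coordinates with index in `J` vanish. -/
noncomputable def vanishing {N : ℕ} (e : OrthonormalBasis (Fin N) ℝ V) (J : Finset (Fin N)) :
    Submodule ℝ V :=
  (Submodule.span ℝ (Set.range fun j : J => e j))ᗮ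

theorem inner_eq_zero_of_mem_vanishing {N : ℕ} {e : OrthonormalBasis (Fin N) ℝ V}
    {J : Finset (Fin N)} {x : V} (hx : x ∈ vanishing e J) {j : Fin N} (hj : j ∈ J) :
    inner ℝ (e j) x = 0 :=
  (Submodule.mem_orthogonal _ _).1 hx _ (Submodule.subset_span ⟨⟨j, hj⟩, rfl⟩)

theorem finrank_le_finrank_vanishing_add [FiniteDimensional ℝ V] {N : ℕ}
    (e : OrthonormalBasis (Fin N) ℝ V) (J : Finset (Fin N)) :
    finrank ℝ V ≤ finrank ℝ (vanishing e J) + J.card := by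
  have h1 := Submodule.finrank_add_finrank_orthogonal
    (Submodule.span ℝ (Set.range fun j : J => e j))
  have h2 := finrank_range_le_card (R := ℝ) fun j : J => e j
  rw [Fintype.card_coe] at h2
  unfold vanishing
  unfold Set.finrank at h2
  omega

theorem norm_sq_eq_sum_inner_sq {N : ℕ} (e : OrthonormalBasis (Fin N) ℝ V) (x : V) :
    ‖x‖ ^ 2 = ∑ j, inner ℝ (e j) x ^ 2 := by
  rw [← e.sum_sq_norm_inner_right x]
  simp

variable [FiniteDimensional ℝ V] {N : ℕ} {D : V →ₗ[ℝ] V}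

theorem inner_apply_self_eq_sum (hD : D.IsSymmetric) (hN : finrank ℝ V = N) (x : V) :
    inner ℝ (D x) x =
      ∑ j, hD.eigenvalues hN j * inner ℝ (hD.eigenvectorBasis hN j) x ^ 2 := by
  rw [← (hD.eigenvectorBasis hN).sum_inner_mul_inner]
  refine Finset.sum_congr rfl fun j _ => ?_
  rw [hD x, LinearMap.IsSymmetric.apply_eigenvectorBasis, inner_smul_right,
    real_inner_comm x]
  simp only [RCLike.ofReal_real_eq_id, id_eq]
  ring

theorem inner_le_eigenvalue_mul_of_mem_vanishing (hD : D.IsSymmetric) (hN : finrank ℝ V = N)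
    (i : Fin N) {x : V} (hx : x ∈ vanishing (hD.eigenvectorBasis hN) (Finset.Iio i)) :
    inner ℝ (D x) x ≤ hD.eigenvalues hN i * ‖x‖ ^ 2 := by
  rw [inner_apply_self_eq_sum hD hN, norm_sq_eq_sum_inner_sq (hD.eigenvectorBasis hN),
    Finset.mul_sum]
  refine Finset.sum_le_sum fun j _ => ?_
  rcases lt_or_ge j i with h | h
  · rw [inner_eq_zero_of_mem_vanishing hx (Finset.mem_Iio.2 h)]
    simp
  · exact mul_le_mul_of_nonneg_right (hD.eigenvalues_antitone hN h) (sq_nonneg _)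

theorem eigenvalue_mul_le_inner_of_mem_vanishing (hD : D.IsSymmetric) (hN : finrank ℝ V = N)
    (i : Fin N) {x : V} (hx : x ∈ vanishing (hD.eigenvectorBasis hN) (Finset.Ioi i)) :
    hD.eigenvalues hN i * ‖x‖ ^ 2 ≤ inner ℝ (D x) x := by
  rw [inner_apply_self_eq_sum hD hN, norm_sq_eq_sum_inner_sq (hD.eigenvectorBasis hN),
    Finset.mul_sum]
  refine Finset.sum_le_sum fun j _ => ?_
  rcases lt_or_ge i j with h | h
  · rw [inner_eq_zero_of_mem_vanishing hx (Finset.mem_Ioi.2 h)]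
    simp
  · exact mul_le_mul_of_nonneg_right (hD.eigenvalues_antitone hN h) (sq_nonneg _)

/-- One half of Courant–Fischer: by dimension count S contains a nonzero vector orthogonal to the
eigenvectors before i, and there the form is at most λ_i‖x‖². -/
theorem le_eigenvalues_of_forall_mem (hD : D.IsSymmetric) (hN : finrank ℝ V = N) (i : Fin N)
    {c : ℝ} (S : Submodule ℝ V) (hS : (i : ℕ) < finrank ℝ S)
    (h : ∀ x ∈ S, c * ‖x‖ ^ 2 ≤ inner ℝ (D x) x) : c ≤ hD.eigenvalues hN i := by
  have h1 := finrank_le_finrank_vanishing_add (hD.eigenvectorBasis hN) (Finset.Iio i)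
  rw [Fin.card_Iio] at h1
  obtain ⟨x, hxS, hxK, hx0⟩ := exists_ne_zero_mem_inf_of_finrank_lt S
    (vanishing (hD.eigenvectorBasis hN) (Finset.Iio i)) (by omega)
  have h2 := (h x hxS).trans (inner_le_eigenvalue_mul_of_mem_vanishing hD hN i hxK)
  exact le_of_mul_le_mul_right h2 (by positivity)

theorem eigenvalues_le_of_forall_mem (hD : D.IsSymmetric) (hN : finrank ℝ V = N) (i : Fin N)
    {c : ℝ} (S : Submodule ℝ V) (hS : N ≤ finrank ℝ S + i)
    (h : ∀ x ∈ S, inner ℝ (D x) x ≤ c * ‖x‖ ^ 2) : hD.eigenvalues hN i ≤ c := by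
  have h1 := finrank_le_finrank_vanishing_add (hD.eigenvectorBasis hN) (Finset.Ioi i)
  rw [Fin.card_Ioi] at h1
  obtain ⟨x, hxS, hxK, hx0⟩ := exists_ne_zero_mem_inf_of_finrank_lt S
    (vanishing (hD.eigenvectorBasis hN) (Finset.Ioi i)) (by omega)
  have h2 := (eigenvalue_mul_le_inner_of_mem_vanishing hD hN i hxK).trans (h x hxS)
  exact le_of_mul_le_mul_right h2 (by positivity)

/-- The span of the first i + 1 eigenvectors of D is a test space for D'. -/
theorem eigenvalues_mono {D' : V →ₗ[ℝ] V} (hD : D.IsSymmetric) (hD' : D'.IsSymmetric)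
    (hN : finrank ℝ V = N) (h : ∀ x, inner ℝ (D x) x ≤ inner ℝ (D' x) x) (i : Fin N) :
    hD.eigenvalues hN i ≤ hD'.eigenvalues hN i := by
  have h1 := finrank_le_finrank_vanishing_add (hD.eigenvectorBasis hN) (Finset.Ioi i)
  rw [Fin.card_Ioi] at h1
  exact le_eigenvalues_of_forall_mem hD' hN i
    (vanishing (hD.eigenvectorBasis hN) (Finset.Ioi i)) (by omega)
    fun x hx => (eigenvalue_mul_le_inner_of_mem_vanishing hD hN i hx).trans (h x)

/-- The spectrum is symmetric about `0` if an isometry reverses the sign of the quadratic form. -/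
theorem eigenvalues_rev_of_inner_neg (hD : D.IsSymmetric) (hN : finrank ℝ V = N)
    (J : V ≃ₗᵢ[ℝ] V) (hJ : ∀ x, inner ℝ (D (J x)) (J x) = -inner ℝ (D x) x) (i : Fin N) :
    hD.eigenvalues hN i.rev = -hD.eigenvalues hN i := by
  have hnorm : ∀ x, ‖J x‖ = ‖x‖ := J.norm_map
  apply le_antisymm
  · have h1 := finrank_le_finrank_vanishing_add (hD.eigenvectorBasis hN) (Finset.Ioi i)
    rw [Fin.card_Ioi] at h1
    have h2 := LinearEquiv.finrank_map_eq J.toLinearEquiv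
      (vanishing (hD.eigenvectorBasis hN) (Finset.Ioi i))
    refine eigenvalues_le_of_forall_mem hD hN i.rev ((vanishing (hD.eigenvectorBasis hN)
      (Finset.Ioi i)).map (J.toLinearEquiv : V →ₗ[ℝ] V)) ?_ ?_
    · rw [h2, Fin.val_rev]
      omega
    · rintro _ ⟨x, hx, rfl⟩
      have h3 := eigenvalue_mul_le_inner_of_mem_vanishing hD hN i hx
      change inner ℝ (D (J x)) (J x) ≤ _ * ‖J x‖ ^ 2
      rw [hJ, hnorm]
      linarith
  · have h1 := finrank_le_finrank_vanishing_add (hD.eigenvectorBasis hN) (Finset.Iio i)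
    rw [Fin.card_Iio] at h1
    have h2 := LinearEquiv.finrank_map_eq J.toLinearEquiv
      (vanishing (hD.eigenvectorBasis hN) (Finset.Iio i))
    refine le_eigenvalues_of_forall_mem hD hN i.rev ((vanishing (hD.eigenvectorBasis hN)
      (Finset.Iio i)).map (J.toLinearEquiv : V →ₗ[ℝ] V)) ?_ ?_
    · rw [h2, Fin.val_rev]
      omega
    · rintro _ ⟨x, hx, rfl⟩
      have h3 := inner_le_eigenvalue_mul_of_mem_vanishing hD hN i hx
      change _ * ‖J x‖ ^ 2 ≤ inner ℝ (D (J x)) (J x)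
      rw [hJ, hnorm]
      linarith

end Variational

/-! ### Min–max for singular values and Weyl's inequality. -/

section SingularValues

variable {E F : Type*} [NormedAddCommGroup E] [InnerProductSpace ℝ E] [FiniteDimensional ℝ E]
  [NormedAddCommGroup F] [InnerProductSpace ℝ F] [FiniteDimensional ℝ F]

/-- An orthonormal basis of right singular vectors. -/
noncomputable def rightSingularBasis (T : E →ₗ[ℝ] F) :
    OrthonormalBasis (Fin (finrank ℝ E)) ℝ E :=
  T.isSymmetric_adjoint_comp_self.eigenvectorBasis rfl

theorem adjoint_apply_rightSingularBasis (T : E →ₗ[ℝ] F) (j : Fin (finrank ℝ E)) :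
    LinearMap.adjoint T (T (rightSingularBasis T j)) =
      T.singularValues j ^ 2 • rightSingularBasis T j := by
  have h := T.isSymmetric_adjoint_comp_self.apply_eigenvectorBasis rfl j
  rw [← T.sq_singularValues_fin rfl j] at h
  exact h

theorem inner_apply_rightSingularBasis_left (T : E →ₗ[ℝ] F) (j : Fin (finrank ℝ E)) (x : E) :
    inner ℝ (T (rightSingularBasis T j)) (T x) =
      T.singularValues j ^ 2 * inner ℝ (rightSingularBasis T j) x := by
  rw [← LinearMap.adjoint_inner_left, adjoint_apply_rightSingularBasis, real_inner_smul_left]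

theorem norm_apply_rightSingularBasis (T : E →ₗ[ℝ] F) (j : Fin (finrank ℝ E)) :
    ‖T (rightSingularBasis T j)‖ = T.singularValues j := by
  rw [← sq_eq_sq₀ (norm_nonneg _) (T.singularValues_nonneg _), ← real_inner_self_eq_norm_sq,
    inner_apply_rightSingularBasis_left, real_inner_self_eq_norm_sq]
  simp

theorem inner_adjoint_comp_self (T : E →ₗ[ℝ] F) (x : E) :
    inner ℝ ((LinearMap.adjoint T ∘ₗ T) x) x = ‖T x‖ ^ 2 := by
  rw [LinearMap.comp_apply, LinearMap.adjoint_inner_left, real_inner_self_eq_norm_sq]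

theorem singularValues_le_of_forall_mem (T : E →ₗ[ℝ] F) (i : ℕ) {c : ℝ} (hc : 0 ≤ c)
    (S : Submodule ℝ E) (hS : finrank ℝ E ≤ finrank ℝ S + i)
    (h : ∀ x ∈ S, ‖T x‖ ≤ c * ‖x‖) : T.singularValues i ≤ c := by
  rcases le_or_gt (finrank ℝ E) i with hi | hi
  · rwa [T.singularValues_of_finrank_le hi]
  rw [← sq_le_sq₀ (T.singularValues_nonneg _) hc, T.sq_singularValues_of_lt rfl hi]
  refine eigenvalues_le_of_forall_mem _ rfl ⟨i, hi⟩ S hS fun x hx => ?_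
  rw [inner_adjoint_comp_self, ← mul_pow]
  exact pow_le_pow_left₀ (norm_nonneg _) (h x hx) 2

/-- The optimal subspace is the orthogonal complement of the first i right singular vectors. With
`singularValues_le_of_forall_mem` it compares singular values through norms alone. -/
theorem exists_submodule_norm_apply_le (T : E →ₗ[ℝ] F) (i : ℕ) :
    ∃ S : Submodule ℝ E, finrank ℝ E ≤ finrank ℝ S + i ∧
      ∀ x ∈ S, ‖T x‖ ≤ T.singularValues i * ‖x‖ := by
  rcases le_or_gt (finrank ℝ E) i with hi | hi
  · refine ⟨⊥, by omega, fun x hx => ?_⟩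
    rw [(Submodule.mem_bot ℝ).1 hx]
    simp
  have h1 := finrank_le_finrank_vanishing_add (rightSingularBasis T) (Finset.Iio ⟨i, hi⟩)
  rw [Fin.card_Iio] at h1
  refine ⟨_, h1, fun x hx => ?_⟩
  rw [← sq_le_sq₀ (norm_nonneg _) (mul_nonneg (T.singularValues_nonneg _) (norm_nonneg _)),
    mul_pow, T.sq_singularValues_of_lt rfl hi, ← inner_adjoint_comp_self]
  exact inner_le_eigenvalue_mul_of_mem_vanishing T.isSymmetric_adjoint_comp_self rfl ⟨i, hi⟩ hx

/-- Weyl's inequality for a perturbation of low rank. -/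
theorem singularValues_add_le (T R : E →ₗ[ℝ] F) {e : ℕ} (he : finrank ℝ R.range ≤ e) (i : ℕ) :
    (T + R).singularValues (i + e) ≤ T.singularValues i := by
  obtain ⟨S, hS, hT⟩ := exists_submodule_norm_apply_le T i
  have h1 := R.finrank_range_add_finrank_ker
  have h2 := Submodule.finrank_sup_add_finrank_inf_eq S R.ker
  have h3 := Submodule.finrank_le (S ⊔ R.ker)
  -- Intersecting with the kernel of R loses at most e dimensions, and there T + R agrees with T.
  refine singularValues_le_of_forall_mem _ _ (T.singularValues_nonneg i) (S ⊓ R.ker) (by omega)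
    fun x hx => ?_
  rw [LinearMap.add_apply, LinearMap.mem_ker.1 hx.2, add_zero]
  exact hT x hx.1

end SingularValues

/-! ### The self-adjoint dilation and Mirsky's inequality. -/

section Dilation

variable {E F : Type*} [NormedAddCommGroup E] [InnerProductSpace ℝ E] [FiniteDimensional ℝ E]
  [NormedAddCommGroup F] [InnerProductSpace ℝ F] [FiniteDimensional ℝ F]

/-- The self-adjoint dilation `(x, y) ↦ (T* y, T x)`. -/
noncomputable def dilation (T : E →ₗ[ℝ] F) : WithLp 2 (E × F) →ₗ[ℝ] WithLp 2 (E × F) where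
  toFun z := WithLp.toLp 2 (LinearMap.adjoint T z.snd, T z.fst)
  map_add' z w := by
    simp only [WithLp.add_fst, WithLp.add_snd, map_add]
    rfl
  map_smul' c z := by
    simp only [WithLp.smul_fst, WithLp.smul_snd, map_smul]
    rfl

theorem dilation_isSymmetric (T : E →ₗ[ℝ] F) : (dilation T).IsSymmetric := by
  intro z w
  simp only [dilation, LinearMap.coe_mk, AddHom.coe_mk, WithLp.prod_inner_apply,
    LinearMap.adjoint_inner_left, LinearMap.adjoint_inner_right]
  exact add_comm _ _

theorem inner_dilation (T : E →ₗ[ℝ] F) (z : WithLp 2 (E × F)) :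
    inner ℝ (dilation T z) z = 2 * inner ℝ (T z.fst) z.snd := by
  simp only [dilation, LinearMap.coe_mk, AddHom.coe_mk, WithLp.prod_inner_apply,
    LinearMap.adjoint_inner_left]
  have := real_inner_comm (T z.fst) z.snd
  change inner ℝ z.snd (T z.fst) + inner ℝ (T z.fst) z.snd = _
  linarith

/-- The isometry `(x, y) ↦ (x, -y)`. -/
noncomputable def negSnd : WithLp 2 (E × F) ≃ₗᵢ[ℝ] WithLp 2 (E × F) where
  toLinearEquiv := LinearEquiv.ofInvolutive
    { toFun := fun z => WithLp.toLp 2 (z.fst, -z.snd)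
      map_add' := fun z w => by
        simp only [WithLp.add_fst, WithLp.add_snd, neg_add]
        rfl
      map_smul' := fun c z => by
        simp only [WithLp.smul_fst, WithLp.smul_snd, ← smul_neg]
        rfl }
    (fun z => by
      change WithLp.toLp 2 (z.fst, - -z.snd) = z
      rw [neg_neg]
      rfl)
  norm_map' z := by
    change ‖WithLp.toLp 2 (z.fst, -z.snd)‖ = ‖z‖
    rw [WithLp.prod_norm_eq_of_L2, WithLp.prod_norm_eq_of_L2]
    simp

theorem finrank_withLp_prod :
    finrank ℝ (WithLp 2 (E × F)) = finrank ℝ E + finrank ℝ F := by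
  rw [(WithLp.linearEquiv 2 ℝ (E × F)).finrank_eq, finrank_prod]

/-- The eigenvalues of the dilation, in decreasing order. -/
noncomputable def dilationEigenvalues (T : E →ₗ[ℝ] F) : Fin (finrank ℝ E + finrank ℝ F) → ℝ :=
  (dilation_isSymmetric T).eigenvalues finrank_withLp_prod

theorem dilationEigenvalues_rev (T : E →ₗ[ℝ] F) (i : Fin (finrank ℝ E + finrank ℝ F)) :
    dilationEigenvalues T i.rev = -dilationEigenvalues T i := by
  refine eigenvalues_rev_of_inner_neg (dilation_isSymmetric T) finrank_withLp_prod negSnd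
    (fun z => ?_) i
  rw [inner_dilation, inner_dilation]
  change 2 * inner ℝ (T z.fst) (-z.snd) = _
  rw [inner_neg_right]
  ring

theorem sum_dilationEigenvalues (T : E →ₗ[ℝ] F) : ∑ i, dilationEigenvalues T i = 0 := by
  have h := Equiv.sum_comp Fin.revPerm (dilationEigenvalues T)
  simp only [Fin.revPerm_apply, dilationEigenvalues_rev, Finset.sum_neg_distrib] at h
  linarith

/-- The partial isometry in the polar decomposition. -/
noncomputable def polarPart (T : E →ₗ[ℝ] F) : E →ₗ[ℝ] F :=
  ∑ j : Fin (finrank ℝ E), (T.singularValues j)⁻¹ •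
    (innerₗ E (rightSingularBasis T j)).smulRight (T (rightSingularBasis T j))

theorem polarPart_apply (T : E →ₗ[ℝ] F) (x : E) :
    polarPart T x = ∑ j : Fin (finrank ℝ E), ((T.singularValues j)⁻¹ *
      inner ℝ (rightSingularBasis T j) x) • T (rightSingularBasis T j) := by
  simp [polarPart, LinearMap.sum_apply, mul_smul]

theorem inner_polarPart (T : E →ₗ[ℝ] F) (x : E) :
    inner ℝ (T x) (polarPart T x) =
      ∑ j : Fin (finrank ℝ E), T.singularValues j * inner ℝ (rightSingularBasis T j) x ^ 2 := by
  rw [polarPart_apply, inner_sum]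
  refine Finset.sum_congr rfl fun j _ => ?_
  rw [real_inner_smul_right, real_inner_comm (T (rightSingularBasis T j)),
    inner_apply_rightSingularBasis_left]
  -- The inverse of 0 is 0, so a vanishing singular value contributes 0 on both sides.
  by_cases h : T.singularValues j = 0
  · simp [h]
  · field_simp

/-- The images of the right singular vectors are orthogonal with norms σ_j, so after normalisation
the nonzero ones are orthonormal. -/
theorem norm_polarPart_le (T : E →ₗ[ℝ] F) (x : E) : ‖polarPart T x‖ ≤ ‖x‖ := by
  have h1 : ∀ j : Fin (finrank ℝ E), inner ℝ (T (rightSingularBasis T j)) (polarPart T x) =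
      T.singularValues j * inner ℝ (rightSingularBasis T j) x := by
    intro j
    rw [polarPart_apply, inner_sum, Finset.sum_eq_single j]
    · rw [real_inner_smul_right, inner_apply_rightSingularBasis_left,
        real_inner_self_eq_norm_sq, (rightSingularBasis T).norm_eq_one]
      by_cases h : T.singularValues j = 0
      · simp [h]
      · field_simp
    · intro k _ hk
      rw [real_inner_smul_right, inner_apply_rightSingularBasis_left,
        (rightSingularBasis T).inner_eq_zero hk.symm]
      simp
    · simp
  rw [← sq_le_sq₀ (norm_nonneg _) (norm_nonneg _), ← real_inner_self_eq_norm_sq (polarPart T x),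
    norm_sq_eq_sum_inner_sq (rightSingularBasis T)]
  nth_rewrite 1 [polarPart_apply]
  rw [sum_inner]
  refine Finset.sum_le_sum fun j _ => ?_
  rw [real_inner_smul_left, h1]
  by_cases h : T.singularValues j = 0
  · simp [h]
    positivity
  · apply le_of_eq
    field_simp

/-- For the upper bound, the test space constrains only x to the optimal subspace of T, where 2⟪Tx,
y⟫ ≤ 2σ_i‖x‖‖y‖ ≤ σ_i(‖x‖² + ‖y‖²). For the lower bound it is the graph of the polar part over the
first i + 1 right singular vectors. -/
theorem dilationEigenvalues_eq (T : E →ₗ[ℝ] F) (i : Fin (finrank ℝ E + finrank ℝ F))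
    (hi : (i : ℕ) < finrank ℝ E) : dilationEigenvalues T i = T.singularValues i := by
  apply le_antisymm
  · obtain ⟨S, hS, hT⟩ := exists_submodule_norm_apply_le T i
    let L : WithLp 2 (E × F) →ₗ[ℝ] E ⧸ S :=
      S.mkQ ∘ₗ LinearMap.fst ℝ E F ∘ₗ (WithLp.linearEquiv 2 ℝ (E × F)).toLinearMap
    have h1 := L.finrank_range_add_finrank_ker
    have h2 := Submodule.finrank_le L.range
    have h3 := S.finrank_quotient_add_finrank
    rw [finrank_withLp_prod] at h1
    refine eigenvalues_le_of_forall_mem _ _ i L.ker (by omega) fun z hz => ?_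
    have hz' : z.fst ∈ S := (Submodule.Quotient.mk_eq_zero S).1 (LinearMap.mem_ker.1 hz)
    rw [inner_dilation, WithLp.prod_norm_sq_eq_of_L2]
    have h4 := real_inner_le_norm (T z.fst) z.snd
    have h5 := mul_le_mul_of_nonneg_right (hT _ hz') (norm_nonneg z.snd)
    have h6 := mul_nonneg (T.singularValues_nonneg i) (sq_nonneg (‖z.fst‖ - ‖z.snd‖))
    nlinarith
  · have h1 := finrank_le_finrank_vanishing_add (rightSingularBasis T) (Finset.Ioi ⟨i, hi⟩)
    rw [Fin.card_Ioi] at h1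
    let L : E →ₗ[ℝ] WithLp 2 (E × F) :=
      (WithLp.linearEquiv 2 ℝ (E × F)).symm.toLinearMap ∘ₗ LinearMap.prod LinearMap.id (polarPart T)
    have hL : Function.Injective L := fun x y h => congrArg WithLp.fst h
    have h2 := ((vanishing (rightSingularBasis T) (Finset.Ioi ⟨i, hi⟩)).equivMapOfInjective L
      hL).finrank_eq
    refine le_eigenvalues_of_forall_mem _ _ i
      ((vanishing (rightSingularBasis T) (Finset.Ioi ⟨i, hi⟩)).map L) (by dsimp only at h1; omega) ?_
    rintro _ ⟨x, hx, rfl⟩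
    rw [inner_dilation, WithLp.prod_norm_sq_eq_of_L2]
    change T.singularValues i * (‖x‖ ^ 2 + ‖polarPart T x‖ ^ 2) ≤
      2 * inner ℝ (T x) (polarPart T x)
    have h3 : T.singularValues i * ‖x‖ ^ 2 ≤ inner ℝ (T x) (polarPart T x) := by
      rw [inner_polarPart, norm_sq_eq_sum_inner_sq (rightSingularBasis T), Finset.mul_sum]
      refine Finset.sum_le_sum fun j _ => ?_
      rcases lt_or_ge (⟨i, hi⟩ : Fin (finrank ℝ E)) j with h | h
      · rw [inner_eq_zero_of_mem_vanishing hx (Finset.mem_Ioi.2 h)]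
        simp
      · exact mul_le_mul_of_nonneg_right (T.singularValues_antitone h) (sq_nonneg _)
    have h4 := mul_le_mul_of_nonneg_left (pow_le_pow_left₀ (norm_nonneg _)
      (norm_polarPart_le T x) 2) (T.singularValues_nonneg i)
    linarith

/-- As 2M ≤ N, the first M indices and their reflections are disjoint. This recovers the factor 2
lost by counting each singular value with both signs. -/
theorem two_mul_sum_range_le_sum_of_rev {N M : ℕ} (hM : 2 * M ≤ N) (d : Fin N → ℝ)
    (hd : ∀ i, 0 ≤ d i) (hrev : ∀ i, d (Fin.rev i) = d i) (g : ℕ → ℝ)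
    (hg : ∀ i : Fin N, (i : ℕ) < M → d i = g i) :
    2 * ∑ i ∈ Finset.range M, g i ≤ ∑ i, d i := by
  have h1 : ∑ i ∈ Finset.range M, g i = ∑ i with (i : Fin N).val < M, d i := by
    symm
    refine Finset.sum_nbij (fun i : Fin N => (i : ℕ)) ?_ ?_ ?_ ?_
    · intro i hi
      simpa using hi
    · intro i _ j _ h
      exact Fin.ext h
    · intro j hj
      have hj' : j < M := by simpa using hj
      exact ⟨⟨j, by omega⟩, by simpa using hj', rfl⟩
    · intro i hi
      exact hg i (by simpa using hi)
  have h2 : ∑ i with (Fin.rev i : Fin N).val < M, d i = ∑ i with (i : Fin N).val < M, d i := by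
    refine Finset.sum_equiv Fin.revPerm (fun i => by simp) fun i _ => ?_
    rw [Fin.revPerm_apply, hrev]
  have h3 : Disjoint (Finset.univ.filter fun i : Fin N => i.val < M)
      (Finset.univ.filter fun i : Fin N => (Fin.rev i).val < M) := by
    rw [Finset.disjoint_filter]
    intro i _ h
    rw [Fin.val_rev]
    omega
  have h4 : ∑ i ∈ (Finset.univ.filter fun i : Fin N => i.val < M) ∪
      (Finset.univ.filter fun i : Fin N => (Fin.rev i).val < M), d i ≤ ∑ i, d i :=
    Finset.sum_le_univ_sum_of_nonneg hd
  rw [Finset.sum_union h3, h2] at h4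
  linarith

/-- A rank-one perturbation `⟪v, ·⟫ w` moves the singular values by at most `‖w‖` in total. -/
theorem sum_abs_singularValues_add_rankOne_sub_le (T : E →ₗ[ℝ] F) {v : E} (hv : ‖v‖ = 1) (w : F)
    {M : ℕ} (hME : M ≤ finrank ℝ E) (hMF : M ≤ finrank ℝ F) :
    ∑ i ∈ Finset.range M, |(T + (innerₗ E v).smulRight w).singularValues i - T.singularValues i| ≤
      ‖w‖ := by
  rcases eq_or_ne w 0 with rfl | hw
  · simp
  have ha : 0 < ‖w‖ := norm_pos_iff.2 hw
  set T' := T + (innerₗ E v).smulRight w with hT'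
  -- The dilation of ⟪v, ·⟫w has form 2⟪v, x⟫⟪w, y⟫, the difference of the squares (‖w‖⟪v, x⟫ ± ⟪w,
  -- y⟫)² divided by 2‖w‖. P is the positive square; the weight ‖w‖ on v balances the two components
  -- and makes its trace ‖w‖.
  let ξ : WithLp 2 (E × F) := WithLp.toLp 2 (‖w‖ • v, w)
  let P : WithLp 2 (E × F) →ₗ[ℝ] WithLp 2 (E × F) :=
    (2 * ‖w‖)⁻¹ • (InnerProductSpace.rankOne ℝ ξ ξ).toLinearMap
  have hP : ∀ z, inner ℝ (P z) z =
      (2 * ‖w‖)⁻¹ * (‖w‖ * inner ℝ v z.fst + inner ℝ w z.snd) ^ 2 := by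
    intro z
    have : inner ℝ ξ z = ‖w‖ * inner ℝ v z.fst + inner ℝ w z.snd := by
      rw [WithLp.prod_inner_apply]
      change inner ℝ (‖w‖ • v) z.fst + inner ℝ w z.snd = _
      rw [real_inner_smul_left]
    rw [← this]
    simp only [P, LinearMap.smul_apply, ContinuousLinearMap.coe_coe,
      InnerProductSpace.rankOne_apply, real_inner_smul_left]
    ring
  have hPsymm : P.IsSymmetric := by
    intro z y
    simp only [P, LinearMap.smul_apply, ContinuousLinearMap.coe_coe,
      InnerProductSpace.rankOne_apply, real_inner_smul_left, real_inner_smul_right]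
    rw [real_inner_comm z ξ]
    ring
  have htrP : LinearMap.trace ℝ _ P = ‖w‖ := by
    have : inner ℝ ξ ξ = 2 * ‖w‖ ^ 2 := by
      rw [real_inner_self_eq_norm_sq, WithLp.prod_norm_sq_eq_of_L2]
      change ‖‖w‖ • v‖ ^ 2 + ‖w‖ ^ 2 = _
      rw [norm_smul, hv, norm_norm]
      ring
    simp only [P, map_smul, InnerProductSpace.trace_rankOne, this, smul_eq_mul]
    field_simp
  have hS := (dilation_isSymmetric T).add hPsymm
  set μ := hS.eigenvalues (finrank_withLp_prod (E := E) (F := F)) with hμ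
  have hsum : ∑ i, μ i = ‖w‖ := by
    have h1 := hS.trace_eq_sum_eigenvalues (finrank_withLp_prod (E := E) (F := F))
    have h2 := (dilation_isSymmetric T).trace_eq_sum_eigenvalues
      (finrank_withLp_prod (E := E) (F := F))
    have h3 := sum_dilationEigenvalues T
    rw [map_add, h2, htrP] at h1
    unfold dilationEigenvalues at h3
    simp only [RCLike.ofReal_real_eq_id, id_eq] at h1
    rw [hμ, ← h1, h3, zero_add]
  -- The dilation of T plus P dominates both dilations: it exceeds that of T by P and that of T' by
  -- the other square.
  have hle : ∀ i, dilationEigenvalues T i ≤ μ i := by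
    refine eigenvalues_mono (dilation_isSymmetric T) hS finrank_withLp_prod fun z => ?_
    rw [LinearMap.add_apply, inner_add_left, hP]
    have : 0 ≤ (2 * ‖w‖)⁻¹ * (‖w‖ * inner ℝ v z.fst + inner ℝ w z.snd) ^ 2 := by positivity
    linarith
  have hle' : ∀ i, dilationEigenvalues T' i ≤ μ i := by
    refine eigenvalues_mono (dilation_isSymmetric T') hS finrank_withLp_prod fun z => ?_
    rw [LinearMap.add_apply, inner_add_left, hP, inner_dilation, inner_dilation, hT',
      LinearMap.add_apply, inner_add_left, LinearMap.smulRight_apply, real_inner_smul_left,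
      innerₗ_apply_apply]
    have : 0 ≤ (2 * ‖w‖)⁻¹ * (‖w‖ * inner ℝ v z.fst - inner ℝ w z.snd) ^ 2 := by positivity
    have h2 : (2 * ‖w‖)⁻¹ * (‖w‖ * inner ℝ v z.fst + inner ℝ w z.snd) ^ 2 =
        (2 * ‖w‖)⁻¹ * (‖w‖ * inner ℝ v z.fst - inner ℝ w z.snd) ^ 2 +
          2 * (inner ℝ v z.fst * inner ℝ w z.snd) := by
      field_simp
      ring
    linarith
  have key := two_mul_sum_range_le_sum_of_rev (M := M) (by omega)
    (fun i => |dilationEigenvalues T' i - dilationEigenvalues T i|) (fun i => abs_nonneg _)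
    (fun i => by
      rw [dilationEigenvalues_rev, dilationEigenvalues_rev, ← abs_neg]
      congr 1
      ring)
    (fun i => |T'.singularValues i - T.singularValues i|)
    (fun i hi => by
      rw [dilationEigenvalues_eq _ i (by omega), dilationEigenvalues_eq _ i (by omega)])
  -- Passing through the common majorant μ costs ‖w‖ for each dilation, since both have trace zero;
  -- the total 2‖w‖ is halved by `key`.
  have h5 : ∑ i, |dilationEigenvalues T' i - dilationEigenvalues T i| ≤
      ∑ i, ((μ i - dilationEigenvalues T' i) + (μ i - dilationEigenvalues T i)) := by
    refine Finset.sum_le_sum fun i _ => ?_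
    have := hle i
    have := hle' i
    rw [abs_le]
    constructor <;> linarith
  simp only [Finset.sum_add_distrib, Finset.sum_sub_distrib, hsum, sum_dilationEigenvalues] at h5
  linarith

/-- Mirsky's inequality, for a perturbation given as a sum of rank-one maps. -/
theorem sum_abs_singularValues_add_sum_rankOne_sub_le {ι : Type*} (T : E →ₗ[ℝ] F) (v : ι → E)
    (hv : ∀ j, ‖v j‖ = 1) (w : ι → F) {M : ℕ} (hME : M ≤ finrank ℝ E) (hMF : M ≤ finrank ℝ F)
    (J : Finset ι) :
    ∑ i ∈ Finset.range M, |(T + ∑ j ∈ J, (innerₗ E (v j)).smulRight (w j)).singularValues i -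
      T.singularValues i| ≤ ∑ j ∈ J, ‖w j‖ := by
  classical
  induction J using Finset.induction_on with
  | empty => simp
  | insert a J ha ih =>
    rw [Finset.sum_insert ha, Finset.sum_insert ha]
    have h1 := sum_abs_singularValues_add_rankOne_sub_le
      (T + ∑ j ∈ J, (innerₗ E (v j)).smulRight (w j)) (hv a) (w a) hME hMF
    have h2 : T + ((innerₗ E (v a)).smulRight (w a) + ∑ j ∈ J, (innerₗ E (v j)).smulRight (w j)) =
        T + ∑ j ∈ J, (innerₗ E (v j)).smulRight (w j) + (innerₗ E (v a)).smulRight (w a) := by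
      abel
    rw [h2]
    refine le_trans (Finset.sum_le_sum fun i _ => abs_sub_le _
      ((T + ∑ j ∈ J, (innerₗ E (v j)).smulRight (w j)).singularValues i) _) ?_
    rw [Finset.sum_add_distrib]
    exact add_le_add h1 ih

end Dilation

/-! ### SVD truncations and the perturbation inequality for min(·, t). -/

section Truncation

variable {E F : Type*} [NormedAddCommGroup E] [InnerProductSpace ℝ E] [FiniteDimensional ℝ E]
  [NormedAddCommGroup F] [InnerProductSpace ℝ F] [FiniteDimensional ℝ F]

/-- The part of the singular value decomposition of `T` with indices in `J`. -/
noncomputable def singularPart (T : E →ₗ[ℝ] F) (J : Finset (Fin (finrank ℝ E))) : E →ₗ[ℝ] F :=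
  ∑ j ∈ J, (innerₗ E (rightSingularBasis T j)).smulRight (T (rightSingularBasis T j))

theorem singularPart_apply_rightSingularBasis (T : E →ₗ[ℝ] F) (J : Finset (Fin (finrank ℝ E)))
    (k : Fin (finrank ℝ E)) : singularPart T J (rightSingularBasis T k) =
      if k ∈ J then T (rightSingularBasis T k) else 0 := by
  simp only [singularPart, LinearMap.sum_apply, LinearMap.smulRight_apply, innerₗ_apply_apply,
    (rightSingularBasis T).inner_eq_ite, ite_smul, one_smul, zero_smul, Finset.sum_ite_eq']

theorem singularPart_univ (T : E →ₗ[ℝ] F) : singularPart T Finset.univ = T :=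
  (rightSingularBasis T).toBasis.ext fun k => by
    simp [singularPart_apply_rightSingularBasis]

theorem singularPart_add_of_disjoint (T : E →ₗ[ℝ] F) {I J : Finset (Fin (finrank ℝ E))}
    (h : Disjoint I J) : singularPart T (I ∪ J) = singularPart T I + singularPart T J := by
  unfold singularPart
  exact Finset.sum_union h

theorem finrank_range_singularPart_le (T : E →ₗ[ℝ] F) (J : Finset (Fin (finrank ℝ E))) :
    finrank ℝ (singularPart T J).range ≤ J.card := by
  have h : (singularPart T J).range ≤
      Submodule.span ℝ (Set.range fun j : J => T (rightSingularBasis T j)) := by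
    rintro _ ⟨x, rfl⟩
    simp only [singularPart, LinearMap.sum_apply, LinearMap.smulRight_apply]
    exact Submodule.sum_mem _ fun j hj =>
      Submodule.smul_mem _ _ (Submodule.subset_span ⟨⟨j, hj⟩, rfl⟩)
  refine (Submodule.finrank_mono h).trans ?_
  have := finrank_range_le_card (R := ℝ) fun j : J => T (rightSingularBasis T j)
  rwa [Fintype.card_coe] at this

theorem sum_sq_singularValues (R : E →ₗ[ℝ] F) {N : ℕ}
    (b : OrthonormalBasis (Fin N) ℝ E) :
    ∑ i : Fin (finrank ℝ E), R.singularValues i ^ 2 = ∑ k, ‖R (b k)‖ ^ 2 := by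
  have h1 := R.isSymmetric_adjoint_comp_self.trace_eq_sum_eigenvalues rfl
  rw [(LinearMap.adjoint R ∘ₗ R).trace_eq_sum_inner b] at h1
  simp only [RCLike.ofReal_real_eq_id, id_eq, ← R.sq_singularValues_fin rfl] at h1
  rw [← h1]
  refine Finset.sum_congr rfl fun k _ => ?_
  rw [real_inner_comm, inner_adjoint_comp_self]

theorem sum_sq_singularValues_singularPart (T : E →ₗ[ℝ] F) (J : Finset (Fin (finrank ℝ E))) :
    ∑ i : Fin (finrank ℝ E), (singularPart T J).singularValues i ^ 2 =
      ∑ j ∈ J, T.singularValues j ^ 2 := by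
  rw [sum_sq_singularValues _ (rightSingularBasis T)]
  simp only [singularPart_apply_rightSingularBasis, apply_ite norm, norm_zero, ite_pow,
    norm_apply_rightSingularBasis]
  simp [Finset.sum_ite_mem]

theorem singularValues_neg (T : E →ₗ[ℝ] F) (i : ℕ) :
    (-T).singularValues i = T.singularValues i := by
  have key : ∀ T : E →ₗ[ℝ] F, (-T).singularValues i ≤ T.singularValues i := by
    intro T
    obtain ⟨S, hS, hT⟩ := exists_submodule_norm_apply_le T i
    refine singularValues_le_of_forall_mem _ _ (T.singularValues_nonneg i) S hS fun x hx => ?_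
    rw [LinearMap.neg_apply, norm_neg]
    exact hT x hx
  refine le_antisymm (key T) ?_
  simpa using key (-T)

theorem singularValues_eq_zero_of_min_le (T : E →ₗ[ℝ] F) {i : ℕ}
    (hi : min (finrank ℝ E) (finrank ℝ F) ≤ i) : T.singularValues i = 0 := by
  rw [T.singularValues_eq_zero_iff_le_finrank_range]
  have h1 := T.finrank_range_le
  have h2 := Submodule.finrank_le T.range
  omega

/-- With U and W the larger and smaller truncated values, interlacing gives U(i + e) ≤ W(i). In Σ(U
- W) all but the first e terms of U are thus absorbed, and each of those is at most t. -/
theorem sum_abs_min_sub_min_le_of_interlace {a b : ℕ → ℝ} {t : ℝ} (ht : 0 ≤ t) {e : ℕ}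
    (ha : Antitone a) (hb : Antitone b) (ha0 : ∀ i, 0 ≤ a i) (hab : ∀ i, a (i + e) ≤ b i)
    (hba : ∀ i, b (i + e) ≤ a i) (N : ℕ) :
    ∑ i ∈ Finset.range N, |min (a i) t - min (b i) t| ≤ t * e := by
  set U : ℕ → ℝ := fun i => max (min (a i) t) (min (b i) t) with hU
  set W : ℕ → ℝ := fun i => min (min (a i) t) (min (b i) t) with hW
  have h1 : ∀ i, |min (a i) t - min (b i) t| = U i - W i := fun i =>
    (max_sub_min_eq_abs' _ _).symm
  have hU0 : ∀ i, 0 ≤ U i := fun i => le_max_of_le_left (le_min (ha0 i) ht)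
  have hUt : ∀ i, U i ≤ t := fun i => max_le (min_le_right _ _) (min_le_right _ _)
  have hUW : ∀ i, U (e + i) ≤ W i := by
    intro i
    rw [add_comm]
    refine max_le (le_min ?_ ?_) (le_min ?_ ?_)
    · exact min_le_min_right _ (ha (Nat.le_add_right i e))
    · exact min_le_min_right _ (hab i)
    · exact min_le_min_right _ (hba i)
    · exact min_le_min_right _ (hb (Nat.le_add_right i e))
  have h2 : ∑ i ∈ Finset.range N, U i ≤ ∑ i ∈ Finset.range (e + N), U i :=
    Finset.sum_le_sum_of_subset_of_nonneg (Finset.range_subset_range.2 (Nat.le_add_left N e))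
      fun i _ _ => hU0 i
  rw [Finset.sum_range_add] at h2
  have h3 : ∑ i ∈ Finset.range e, U i ≤ t * e := by
    refine (Finset.sum_le_sum fun i _ => hUt i).trans ?_
    rw [Finset.sum_const, Finset.card_range, nsmul_eq_mul, mul_comm]
  have h4 : ∑ i ∈ Finset.range N, U (e + i) ≤ ∑ i ∈ Finset.range N, W i :=
    Finset.sum_le_sum fun i _ => hUW i
  simp only [h1, Finset.sum_sub_distrib]
  linarith

/-- The perturbation inequality for the concave function `min · t` of the singular values. -/
theorem sum_abs_min_singularValues_sub_le (T A : E →ₗ[ℝ] F) {t : ℝ} (ht : 0 < t) {N : ℕ}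
    (hN : min (finrank ℝ E) (finrank ℝ F) ≤ N) :
    ∑ i ∈ Finset.range N, |min ((T + A).singularValues i) t - min (T.singularValues i) t| ≤
      ∑ i ∈ Finset.range N, min (A.singularValues i) t := by
  set M := min (finrank ℝ E) (finrank ℝ F) with hM
  have hzero : ∀ R : E →ₗ[ℝ] F, ∀ i ≥ M, R.singularValues i = 0 :=
    fun R i hi => singularValues_eq_zero_of_min_le R hi
  have hmin : ∀ i ≥ M, min (A.singularValues i) t = 0 :=
    fun i hi => by rw [hzero _ i hi, min_eq_left ht.le]
  rw [Finset.eventually_constant_sum (fun i hi => by simp [hzero _ i hi]) hN,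
    Finset.eventually_constant_sum hmin hN,
    ← Finset.eventually_constant_sum hmin (min_le_left _ _),
    Finset.sum_range fun i => min (A.singularValues i) t]
  -- Splitting at the threshold t makes the costs sharp: t for each index in J, the singular value
  -- itself otherwise, which is min(σ_j, t) in both cases.
  set J : Finset (Fin (finrank ℝ E)) := Finset.univ.filter fun j => t < A.singularValues j with hJ
  have hA : A = singularPart A J + singularPart A Jᶜ := by
    rw [← singularPart_add_of_disjoint _ disjoint_compl_right, Finset.union_compl,
      singularPart_univ]
  have hrank := finrank_range_singularPart_le A J
  set T' := T + singularPart A J with hT'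
  have h1 : ∑ i ∈ Finset.range M, |min (T'.singularValues i) t - min (T.singularValues i) t| ≤
      t * J.card := by
    refine sum_abs_min_sub_min_le_of_interlace ht.le T'.singularValues_antitone
      T.singularValues_antitone T'.singularValues_nonneg
      (fun i => singularValues_add_le T _ hrank i) (fun i => ?_) M
    have h2 := singularValues_add_le T' (-singularPart A J) (e := J.card)
      (by rwa [LinearMap.range_neg]) i
    rwa [hT', add_neg_cancel_right] at h2
  have h2 : ∑ i ∈ Finset.range M, |(T + A).singularValues i - T'.singularValues i| ≤
      ∑ j ∈ Jᶜ, A.singularValues j := by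
    have h3 := sum_abs_singularValues_add_sum_rankOne_sub_le T'
      (rightSingularBasis A) (rightSingularBasis A).norm_eq_one
      (fun j => A (rightSingularBasis A j)) (M := M) (min_le_left _ _) (min_le_right _ _) Jᶜ
    simp only [norm_apply_rightSingularBasis] at h3
    have h4 : T + A = T' + singularPart A Jᶜ := by
      rw [hT', add_assoc, ← hA]
    rw [h4]
    exact h3
  have h3 : ∑ j : Fin (finrank ℝ E), min (A.singularValues j) t =
      t * J.card + ∑ j ∈ Jᶜ, A.singularValues j := by
    rw [← Finset.sum_add_sum_compl J]
    congr 1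
    · rw [Finset.sum_congr rfl (g := fun _ => t) fun j hj => min_eq_right
        (Finset.mem_filter.1 hj).2.le, Finset.sum_const, nsmul_eq_mul, mul_comm]
    · refine Finset.sum_congr rfl fun j hj => min_eq_left ?_
      by_contra hlt
      exact Finset.mem_compl.1 hj (Finset.mem_filter.2 ⟨Finset.mem_univ _, not_le.1 hlt⟩)
  rw [h3]
  refine le_trans (Finset.sum_le_sum fun i _ => abs_sub_le _ (min (T'.singularValues i) t) _) ?_
  rw [Finset.sum_add_distrib, add_comm (t * _)]
  refine add_le_add (le_trans (Finset.sum_le_sum fun i _ => ?_) h2) h1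
  -- Truncation at t is 1-Lipschitz, so the untruncated Mirsky bound applies.
  exact (abs_min_sub_min_le_max _ _ _ _).trans (by simp)

end Truncation

/-! ### From min(·, t) to the p-th power. -/

section ConcavePower

open MeasureTheory Set

/-- Represents x^p as a positive mixture of the functions min(x, t). The weight t^(p-2) is
integrable against them near 0 because p > 0 and near infinity because p < 1. -/
theorem integrableOn_min_mul_rpow_and_integral_eq {p x : ℝ} (hp : 0 < p) (hp1 : p < 1)
    (hx : 0 ≤ x) :
    IntegrableOn (fun t : ℝ => min x t * t ^ (p - 2)) (Ioi 0) ∧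
      ∫ t in Ioi (0 : ℝ), min x t * t ^ (p - 2) = (1 / p + 1 / (1 - p)) * x ^ p := by
  rcases hx.eq_or_lt with rfl | hx
  · have h0 : EqOn (fun t : ℝ => min 0 t * t ^ (p - 2)) (fun _ => 0) (Ioi 0) := fun t ht => by
      simp [min_eq_left (le_of_lt (mem_Ioi.1 ht))]
    refine ⟨(integrableOn_congr_fun h0 measurableSet_Ioi).2 integrableOn_zero, ?_⟩
    rw [setIntegral_congr_fun measurableSet_Ioi h0, Real.zero_rpow hp.ne']
    simp
  have e1 : EqOn (fun t : ℝ => min x t * t ^ (p - 2)) (fun t => t ^ (p - 1)) (Ioc 0 x) :=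
    fun t ht => by
      simp only
      rw [min_eq_right ht.2, show p - 1 = 1 + (p - 2) by ring, Real.rpow_add ht.1, Real.rpow_one]
  have e2 : EqOn (fun t : ℝ => min x t * t ^ (p - 2)) (fun t => x * t ^ (p - 2)) (Ioi x) :=
    fun t ht => by
      simp only
      rw [min_eq_left (le_of_lt (mem_Ioi.1 ht))]
  have i1 : IntegrableOn (fun t : ℝ => min x t * t ^ (p - 2)) (Ioc 0 x) := by
    rw [integrableOn_congr_fun e1 measurableSet_Ioc,
      ← intervalIntegrable_iff_integrableOn_Ioc_of_le hx.le]
    exact intervalIntegral.intervalIntegrable_rpow' (by linarith)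
  have i2 : IntegrableOn (fun t : ℝ => min x t * t ^ (p - 2)) (Ioi x) := by
    rw [integrableOn_congr_fun e2 measurableSet_Ioi]
    exact (integrableOn_Ioi_rpow_of_lt (by linarith) hx).const_mul x
  rw [← Ioc_union_Ioi_eq_Ioi hx.le]
  refine ⟨i1.union i2, ?_⟩
  rw [setIntegral_union (Ioc_disjoint_Ioi le_rfl) measurableSet_Ioi i1 i2,
    setIntegral_congr_fun measurableSet_Ioc e1, setIntegral_congr_fun measurableSet_Ioi e2,
    ← intervalIntegral.integral_of_le hx.le, integral_rpow (Or.inl (by linarith)),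
    integral_const_mul, integral_Ioi_rpow_of_lt (by linarith) hx, sub_add_cancel,
    Real.zero_rpow hp.ne', show p - 2 + 1 = p - 1 by ring]
  have h1 : x * x ^ (p - 1) = x ^ p := by
    rw [← Real.rpow_one_add' hx.le (by linarith)]
    congr 1
    ring
  have h2 : p - 1 ≠ 0 := by linarith
  have h3 : 1 - p ≠ 0 := by linarith
  rw [← h1]
  field_simp
  ring

/-- A linear inequality valid for all the functions `min · t` is valid for `· ^ p`, `p ≤ 1`. -/
theorem sum_mul_rpow_nonneg_of_sum_mul_min_nonneg {ι : Type*} (s : Finset ι) (c x : ι → ℝ)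
    (hx : ∀ i, 0 ≤ x i) (h : ∀ t > 0, 0 ≤ ∑ i ∈ s, c i * min (x i) t) {p : ℝ} (hp : 0 < p)
    (hp1 : p ≤ 1) : 0 ≤ ∑ i ∈ s, c i * x i ^ p := by
  rcases hp1.eq_or_lt with rfl | hp1
  · have h1 := h (∑ i ∈ s, x i + 1) (by
      have := Finset.sum_nonneg fun i (_ : i ∈ s) => hx i
      linarith)
    refine h1.trans (Finset.sum_le_sum fun i hi => ?_)
    rw [Real.rpow_one, min_eq_left]
    have := Finset.single_le_sum (fun i _ => hx i) hi
    linarith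
  have h1 : 0 ≤ ∫ t in Ioi (0 : ℝ), (∑ i ∈ s, c i * min (x i) t) * t ^ (p - 2) :=
    setIntegral_nonneg measurableSet_Ioi fun t ht =>
      mul_nonneg (h t ht) (Real.rpow_nonneg (le_of_lt ht) _)
  simp only [Finset.sum_mul, mul_assoc] at h1
  rw [integral_finsetSum _ fun i _ =>
    (integrableOn_min_mul_rpow_and_integral_eq hp hp1 (hx i)).1.const_mul (c i)] at h1
  simp only [integral_const_mul, fun i =>
    (integrableOn_min_mul_rpow_and_integral_eq hp hp1 (hx i)).2] at h1
  have h2 : ∑ i ∈ s, c i * ((1 / p + 1 / (1 - p)) * x i ^ p) =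
      (1 / p + 1 / (1 - p)) * ∑ i ∈ s, c i * x i ^ p := by
    rw [Finset.mul_sum]
    exact Finset.sum_congr rfl fun i _ => by ring
  rw [h2] at h1
  have h3 : 0 < 1 - p := by linarith
  exact nonneg_of_mul_nonneg_right h1 (by positivity)

end ConcavePower

/-! ### Perturbation of p-th powers and the cone condition. -/

section Perturbation

variable {E F : Type*} [NormedAddCommGroup E] [InnerProductSpace ℝ E] [FiniteDimensional ℝ E]
  [NormedAddCommGroup F] [InnerProductSpace ℝ F] [FiniteDimensional ℝ F]

/-- The perturbation inequality for the `p`-th powers of singular values, `0 < p ≤ 1`, with fixed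
signs `ε`. -/
theorem sum_mul_singularValues_rpow_sub_le (T A : E →ₗ[ℝ] F) {p : ℝ} (hp : 0 < p) (hp1 : p ≤ 1)
    {N : ℕ} (hN : min (finrank ℝ E) (finrank ℝ F) ≤ N) (ε : ℕ → ℝ) (hε : ∀ i, |ε i| ≤ 1) :
    ∑ i ∈ Finset.range N, ε i * ((T + A).singularValues i ^ p - T.singularValues i ^ p) ≤
      ∑ i ∈ Finset.range N, A.singularValues i ^ p := by
  -- The `Fin 3` factor packs the three families of singular values, with coefficients 1, -ε and ε,
  -- into one linear inequality.
  have h := sum_mul_rpow_nonneg_of_sum_mul_min_nonneg (Finset.univ ×ˢ Finset.range N)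
    (fun j : Fin 3 × ℕ => ![1, -ε j.2, ε j.2] j.1)
    (fun j => ![A.singularValues j.2, (T + A).singularValues j.2, T.singularValues j.2] j.1)
    (by
      rintro ⟨j, i⟩
      fin_cases j
      · exact A.singularValues_nonneg i
      · exact (T + A).singularValues_nonneg i
      · exact T.singularValues_nonneg i) ?_ hp hp1
  · rw [Finset.sum_product, Fin.sum_univ_three] at h
    simp only [Matrix.cons_val, one_mul, neg_mul, Finset.sum_neg_distrib] at h
    simp only [mul_sub, Finset.sum_sub_distrib]
    linarith
  · intro t ht
    rw [Finset.sum_product, Fin.sum_univ_three]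
    simp only [Matrix.cons_val, one_mul, neg_mul, Finset.sum_neg_distrib]
    have h1 := sum_abs_min_singularValues_sub_le T A ht hN
    have h2 : ∑ i ∈ Finset.range N,
        ε i * (min ((T + A).singularValues i) t - min (T.singularValues i) t) ≤
        ∑ i ∈ Finset.range N, |min ((T + A).singularValues i) t - min (T.singularValues i) t| := by
      refine Finset.sum_le_sum fun i _ => (le_abs_self _).trans ?_
      rw [abs_mul]
      exact mul_le_of_le_one_left (abs_nonneg _) (hε i)
    simp only [mul_sub, Finset.sum_sub_distrib] at h2
    linarith

/-- If `T + H` is not larger than `T` in the Schatten `p`-quasi-norm, the tail of the singular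
values of `H` is dominated by their head, up to the tail of the singular values of `T`. -/
theorem sum_tail_singularValues_rpow_le (T H : E →ₗ[ℝ] F) {p : ℝ} (hp : 0 < p) (hp1 : p ≤ 1)
    {r K : ℕ} (hN : min (finrank ℝ E) (finrank ℝ F) ≤ r + K)
    (h : ∑ i ∈ Finset.range (r + K), (T + H).singularValues i ^ p ≤
      ∑ i ∈ Finset.range (r + K), T.singularValues i ^ p) :
    ∑ i ∈ Finset.range K, H.singularValues (r + i) ^ p ≤
      ∑ i ∈ Finset.range r, H.singularValues i ^ p +
        2 * ∑ i ∈ Finset.range K, T.singularValues (r + i) ^ p := by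
  -- Perturbing -H by T + H gives T. With signs + on the head and - on the tail, the head of T
  -- cancels against the minimality bound and its tail is counted twice.
  have h1 := sum_mul_singularValues_rpow_sub_le (-H) (T + H) hp hp1 hN
    (fun i => if i < r then 1 else -1) (fun i => by split_ifs <;> simp)
  have h2 : -H + (T + H) = T := by abel
  rw [h2] at h1
  simp only [singularValues_neg] at h1
  have h3 := h1.trans h
  rw [Finset.sum_range_add, Finset.sum_range_add] at h3
  have h4 : ∑ i ∈ Finset.range r, (if i < r then (1 : ℝ) else -1) *
      (T.singularValues i ^ p - H.singularValues i ^ p) =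
      ∑ i ∈ Finset.range r, (T.singularValues i ^ p - H.singularValues i ^ p) :=
    Finset.sum_congr rfl fun i hi => by rw [if_pos (Finset.mem_range.1 hi), one_mul]
  have h5 : ∑ i ∈ Finset.range K, (if r + i < r then (1 : ℝ) else -1) *
      (T.singularValues (r + i) ^ p - H.singularValues (r + i) ^ p) =
      ∑ i ∈ Finset.range K, (H.singularValues (r + i) ^ p - T.singularValues (r + i) ^ p) :=
    Finset.sum_congr rfl fun i hi => by
      rw [if_neg (by omega)]
      ring
  rw [h4, h5, Finset.sum_sub_distrib, Finset.sum_sub_distrib] at h3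
  linarith

end Perturbation

/-! ### Inequalities for sums of powers and for blocks. -/

section Sequences

theorem sum_range_mul_eq (f : ℕ → ℝ) (K s : ℕ) :
    ∑ i ∈ Finset.range (K * s), f i =
      ∑ j ∈ Finset.range K, ∑ i ∈ Finset.range s, f (j * s + i) := by
  induction K with
  | zero => simp
  | succ K ih => rw [Nat.succ_mul, Finset.sum_range_add, ih, Finset.sum_range_succ]

theorem rpow_sum_le_sum_rpow {ι : Type*} (J : Finset ι) (f : ι → ℝ) (hf : ∀ i, 0 ≤ f i) {c : ℝ}
    (hc : 0 < c) (hc1 : c ≤ 1) : (∑ i ∈ J, f i) ^ c ≤ ∑ i ∈ J, f i ^ c := by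
  classical
  induction J using Finset.induction_on with
  | empty => simp [Real.zero_rpow hc.ne']
  | insert a J ha ih =>
    rw [Finset.sum_insert ha, Finset.sum_insert ha]
    exact (Real.rpow_add_le_add_rpow (hf a) (Finset.sum_nonneg fun i _ => hf i) hc.le hc1).trans
      (by linarith)

theorem sum_rpow_le_rpow_sum {ι : Type*} (J : Finset ι) (f : ι → ℝ) (hf : ∀ i, 0 ≤ f i) {c : ℝ}
    (hc : 1 ≤ c) : ∑ i ∈ J, f i ^ c ≤ (∑ i ∈ J, f i) ^ c := by
  classical
  induction J using Finset.induction_on with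
  | empty => simp [Real.zero_rpow (by linarith : c ≠ 0)]
  | insert a J ha ih =>
    rw [Finset.sum_insert ha, Finset.sum_insert ha]
    exact le_trans (by linarith)
      (Real.add_rpow_le_rpow_add (hf a) (Finset.sum_nonneg fun i _ => hf i) hc)

/-- Comparison of `ℓ_p` and `ℓ_2` for `p ≤ 2`. -/
theorem sum_rpow_le_card_mul_rpow {ι : Type*} (J : Finset ι) (f : ι → ℝ) (hf : ∀ i, 0 ≤ f i)
    {p : ℝ} (hp : 0 < p) (hp2 : p ≤ 2) :
    ∑ i ∈ J, f i ^ p ≤ (J.card : ℝ) ^ (1 - p / 2) * (∑ i ∈ J, f i ^ 2) ^ (p / 2) := by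
  have h := Real.rpow_sum_le_const_mul_sum_rpow_of_nonneg (s := J) (f := fun i => f i ^ p)
    (p := 2 / p) (by rw [le_div_iff₀ hp]; linarith) fun i _ => Real.rpow_nonneg (hf i) p
  have h0 : 0 ≤ ∑ i ∈ J, f i ^ p := Finset.sum_nonneg fun i _ => Real.rpow_nonneg (hf i) p
  have h1 : ∀ i, (f i ^ p) ^ (2 / p) = f i ^ 2 := fun i => by
    rw [← Real.rpow_mul (hf i), mul_div_cancel₀ _ hp.ne', Real.rpow_two]
  simp only [h1] at h
  have h2 := Real.rpow_le_rpow (Real.rpow_nonneg h0 _) h (by positivity : 0 ≤ p / 2)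
  rw [← Real.rpow_mul h0, Real.mul_rpow (by positivity)
    (Finset.sum_nonneg fun i _ => sq_nonneg _), ← Real.rpow_mul (Nat.cast_nonneg _)] at h2
  have e1 : 2 / p * (p / 2) = 1 := by field_simp
  have e2 : (2 / p - 1) * (p / 2) = 1 - p / 2 := by field_simp
  rwa [e1, e2, Real.rpow_one] at h2

/-- The `ℓ_2` norms of consecutive blocks of length `s` of a decreasing sequence, without the first
block, are controlled by the `ℓ_p` norm of the sequence. -/
theorem sum_block_rpow_le {g : ℕ → ℝ} (hg : Antitone g) (hg0 : ∀ i, 0 ≤ g i) {p q : ℝ}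
    (hp : 0 < p) (hpq : p ≤ q) {s : ℕ} (hs : 0 < s) (K : ℕ) :
    ∑ j ∈ Finset.range K, (∑ i ∈ Finset.range s, g (s + (j * s + i)) ^ 2) ^ (q / 2) ≤
      (s : ℝ) ^ (-((1 / p - 1 / 2) * q)) *
        (∑ i ∈ Finset.range (s + K * s), g i ^ p) ^ (q / p) := by
  have hs' : (0 : ℝ) < s := Nat.cast_pos.2 hs
  have hq : 0 < q := hp.trans_le hpq
  set W : ℕ → ℝ := fun j => ∑ i ∈ Finset.range s, g (j * s + i) ^ p with hW
  have hW0 : ∀ j, 0 ≤ W j := fun j => Finset.sum_nonneg fun i _ => Real.rpow_nonneg (hg0 _) p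
  have h1 : ∀ j, (∑ i ∈ Finset.range s, g (s + (j * s + i)) ^ 2) ^ (q / 2) ≤
      (s : ℝ) ^ (-((1 / p - 1 / 2) * q)) * W j ^ (q / p) := by
    intro j
    -- By monotonicity each entry of a block is at most every entry of the preceding one, hence at
    -- most its p-average.
    have h2 : ∀ i, g (s + (j * s + i)) ^ p ≤ W j / s := by
      intro i
      rw [le_div_iff₀ hs']
      calc g (s + (j * s + i)) ^ p * s = ∑ _i ∈ Finset.range s, g (s + (j * s + i)) ^ p := by
            rw [Finset.sum_const, Finset.card_range, nsmul_eq_mul, mul_comm]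
        _ ≤ W j := Finset.sum_le_sum fun l hl => Real.rpow_le_rpow (hg0 _)
            (hg (by have := Finset.mem_range.1 hl; omega)) hp.le
    have h3 : ∀ i, g (s + (j * s + i)) ^ 2 ≤ (W j / s) ^ (2 / p) := by
      intro i
      have h4 := Real.rpow_le_rpow (Real.rpow_nonneg (hg0 _) _) (h2 i)
        (by positivity : 0 ≤ 2 / p)
      rwa [← Real.rpow_mul (hg0 _), mul_div_cancel₀ _ hp.ne', Real.rpow_two] at h4
    have h5 : ∑ i ∈ Finset.range s, g (s + (j * s + i)) ^ 2 ≤ s * (W j / s) ^ (2 / p) := by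
      refine (Finset.sum_le_sum fun i _ => h3 i).trans ?_
      rw [Finset.sum_const, Finset.card_range, nsmul_eq_mul]
    refine (Real.rpow_le_rpow (Finset.sum_nonneg fun i _ => sq_nonneg _) h5
      (by positivity : 0 ≤ q / 2)).trans (le_of_eq ?_)
    have h6 : 0 ≤ W j / s := div_nonneg (hW0 j) hs'.le
    rw [Real.mul_rpow hs'.le (Real.rpow_nonneg h6 _), ← Real.rpow_mul h6,
      show 2 / p * (q / 2) = q / p by field_simp, Real.div_rpow (hW0 j) hs'.le,
      show -((1 / p - 1 / 2) * q) = q / 2 - q / p by ring, Real.rpow_sub hs']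
    ring
  refine (Finset.sum_le_sum fun j _ => h1 j).trans ?_
  rw [← Finset.mul_sum]
  refine mul_le_mul_of_nonneg_left ?_ (Real.rpow_nonneg hs'.le _)
  refine (sum_rpow_le_rpow_sum _ _ hW0 (by rwa [le_div_iff₀ hp, one_mul])).trans ?_
  refine Real.rpow_le_rpow (Finset.sum_nonneg fun j _ => hW0 j) ?_ (by positivity)
  rw [← sum_range_mul_eq fun i => g i ^ p]
  exact Finset.sum_le_sum_of_subset_of_nonneg
    (Finset.range_subset_range.2 (Nat.le_add_left _ _)) fun i _ _ => Real.rpow_nonneg (hg0 i) p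

end Sequences

/-! ### Translation to matrices, Schatten norms and ℓ_q norms. -/

section Matrices

variable {m n L : ℕ}

theorem singVal_nonneg (X : Matrix (Fin m) (Fin n) ℝ) (j : ℕ) : 0 ≤ singVal X j :=
  LinearMap.singularValues_nonneg _ _

theorem singVal_antitone (X : Matrix (Fin m) (Fin n) ℝ) : Antitone (singVal X) :=
  LinearMap.singularValues_antitone _

theorem singVal_eq_zero (X : Matrix (Fin m) (Fin n) ℝ) {j : ℕ} (hj : min m n ≤ j) :
    singVal X j = 0 :=
  singularValues_eq_zero_of_min_le _ (by simpa [min_comm] using hj)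

theorem schattenNorm_nonneg (p : ℝ) (X : Matrix (Fin m) (Fin n) ℝ) : 0 ≤ schattenNorm p X :=
  Real.rpow_nonneg (Finset.sum_nonneg fun j _ => Real.rpow_nonneg (singVal_nonneg X j) p) _

theorem schattenNorm_eq {p : ℝ} (hp : 0 < p) (X : Matrix (Fin m) (Fin n) ℝ) {N : ℕ}
    (hN : min m n ≤ N) :
    schattenNorm p X = (∑ j ∈ Finset.range N, singVal X j ^ p) ^ (1 / p) := by
  rw [schattenNorm, Finset.eventually_constant_sum
    (fun i hi => by rw [singVal_eq_zero X hi, Real.zero_rpow hp.ne']) hN]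

theorem schattenNorm_rpow {p : ℝ} (hp : 0 < p) (X : Matrix (Fin m) (Fin n) ℝ) {N : ℕ}
    (hN : min m n ≤ N) :
    schattenNorm p X ^ p = ∑ j ∈ Finset.range N, singVal X j ^ p := by
  rw [schattenNorm_eq hp X hN, ← Real.rpow_mul
    (Finset.sum_nonneg fun j _ => Real.rpow_nonneg (singVal_nonneg X j) p),
    one_div_mul_cancel hp.ne', Real.rpow_one]

theorem schattenNorm_two_rpow (q : ℝ) (X : Matrix (Fin m) (Fin n) ℝ) {N : ℕ}
    (hN : min m n ≤ N) :
    schattenNorm 2 X ^ q = (∑ j ∈ Finset.range N, singVal X j ^ 2) ^ (q / 2) := by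
  rw [schattenNorm_eq two_pos X hN]
  simp only [Real.rpow_two]
  rw [← Real.rpow_mul (Finset.sum_nonneg fun j _ => sq_nonneg _)]
  congr 1
  ring

theorem finrank_range_toEuclideanLin (X : Matrix (Fin m) (Fin n) ℝ) :
    finrank ℝ (Matrix.toEuclideanLin X).range = X.rank := by
  rw [Matrix.toEuclideanLin_eq_toLin_orthonormal]
  exact (X.rank_eq_finrank_range_toLin _ _).symm

/-- The part of the singular value decomposition of `X` with indices in `I`. -/
noncomputable def svdPart (X : Matrix (Fin m) (Fin n) ℝ) (I : Finset ℕ) :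
    Matrix (Fin m) (Fin n) ℝ :=
  Matrix.toEuclideanLin.symm (singularPart (Matrix.toEuclideanLin X)
    (Finset.univ.filter fun j => (j : ℕ) ∈ I))

theorem toEuclideanLin_svdPart (X : Matrix (Fin m) (Fin n) ℝ) (I : Finset ℕ) :
    Matrix.toEuclideanLin (svdPart X I) = singularPart (Matrix.toEuclideanLin X)
      (Finset.univ.filter fun j => (j : ℕ) ∈ I) :=
  LinearEquiv.apply_symm_apply _ _

theorem rank_svdPart_le (X : Matrix (Fin m) (Fin n) ℝ) (I : Finset ℕ) :
    (svdPart X I).rank ≤ I.card := by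
  rw [← finrank_range_toEuclideanLin, toEuclideanLin_svdPart]
  refine (finrank_range_singularPart_le _ _).trans ?_
  exact Finset.card_le_card_of_injOn (fun j => (j : ℕ)) (fun j hj => (Finset.mem_filter.1 hj).2)
    fun i _ j _ h => Fin.ext h

theorem svdPart_union (X : Matrix (Fin m) (Fin n) ℝ) {I J : Finset ℕ} (h : Disjoint I J) :
    svdPart X (I ∪ J) = svdPart X I + svdPart X J := by
  apply Matrix.toEuclideanLin.injective
  rw [map_add, toEuclideanLin_svdPart, toEuclideanLin_svdPart, toEuclideanLin_svdPart,
    ← singularPart_add_of_disjoint]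
  · congr 1
    ext j
    simp
  · rw [Finset.disjoint_filter]
    exact fun j _ h1 h2 => Finset.disjoint_left.1 h h1 h2

theorem svdPart_range (X : Matrix (Fin m) (Fin n) ℝ) {N : ℕ} (hN : min m n ≤ N) :
    svdPart X (Finset.range N) = X := by
  apply Matrix.toEuclideanLin.injective
  rw [toEuclideanLin_svdPart]
  refine (rightSingularBasis (Matrix.toEuclideanLin X)).toBasis.ext fun k => ?_
  rw [OrthonormalBasis.coe_toBasis, singularPart_apply_rightSingularBasis]
  split_ifs with h
  · rfl
  · symm
    rw [← norm_eq_zero, norm_apply_rightSingularBasis]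
    refine singVal_eq_zero X (hN.trans ?_)
    simpa using h

theorem schattenNorm_two_svdPart_rpow (q : ℝ) (X : Matrix (Fin m) (Fin n) ℝ) (I : Finset ℕ) :
    schattenNorm 2 (svdPart X I) ^ q = (∑ i ∈ I, singVal X i ^ 2) ^ (q / 2) := by
  rw [schattenNorm_two_rpow q _ (N := n) (min_le_right _ _)]
  congr 1
  have h1 := sum_sq_singularValues_singularPart (Matrix.toEuclideanLin X)
    (Finset.univ.filter fun j => (j : ℕ) ∈ I)
  rw [← toEuclideanLin_svdPart, ← Finset.sum_range
    fun i => (Matrix.toEuclideanLin (svdPart X I)).singularValues i ^ 2,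
    finrank_euclideanSpace_fin] at h1
  refine h1.trans ?_
  have h2 : ∑ i ∈ I, singVal X i ^ 2 =
      ∑ i ∈ I with i < n, singVal X i ^ 2 := by
    rw [Finset.sum_filter]
    refine Finset.sum_congr rfl fun i _ => ?_
    split_ifs with h
    · rfl
    · rw [singVal_eq_zero X (by omega)]
      simp
  rw [h2]
  refine Finset.sum_nbij (fun j => (j : ℕ)) ?_ ?_ ?_ ?_
  · intro j hj
    exact Finset.mem_filter.2 ⟨(Finset.mem_filter.1 hj).2, j.2⟩
  · intro i _ j _ h
    exact Fin.ext h
  · intro i hi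
    have hi' := Finset.mem_filter.1 (Finset.mem_coe.1 hi)
    exact ⟨⟨i, hi'.2⟩, by simpa using hi'.1, rfl⟩
  · intro i _
    rfl

/-- Weyl's inequality for X = (X - Y) + Y. It replaces the tail of X by the full quasi-norm of the
approximation error. -/
theorem singVal_add_le_of_rank_le (X Y : Matrix (Fin m) (Fin n) ℝ) {r : ℕ} (hY : Y.rank ≤ r)
    (i : ℕ) : singVal X (r + i) ≤ singVal (X - Y) i := by
  have h := singularValues_add_le (Matrix.toEuclideanLin (X - Y)) (Matrix.toEuclideanLin Y)
    (e := r) (by rwa [finrank_range_toEuclideanLin]) i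
  rw [← map_add, sub_add_cancel, add_comm] at h
  exact h

/-- Duality of the trace and operator norms: the trace is computed in the right singular basis of X,
whose images have norms σ_j(X). -/
theorem trace_transpose_mul_le (X B : Matrix (Fin m) (Fin n) ℝ) :
    (X.transpose * B).trace ≤
      (∑ j ∈ Finset.range n, singVal X j) * schattenInfNorm B := by
  set T := Matrix.toEuclideanLin X with hT
  set R := Matrix.toEuclideanLin B with hR
  have h1 : ∀ {N : ℕ} (b : OrthonormalBasis (Fin N) ℝ (EuclideanSpace ℝ (Fin n))),
      LinearMap.trace ℝ _ (LinearMap.adjoint T ∘ₗ R) = ∑ k, inner ℝ (T (b k)) (R (b k)) := by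
    intro N b
    rw [LinearMap.trace_eq_sum_inner _ b]
    refine Finset.sum_congr rfl fun k _ => ?_
    rw [LinearMap.comp_apply, LinearMap.adjoint_inner_right]
  have h2 : (X.transpose * B).trace = LinearMap.trace ℝ _ (LinearMap.adjoint T ∘ₗ R) := by
    rw [h1 (EuclideanSpace.basisFun (Fin n) ℝ)]
    simp only [Matrix.trace, Matrix.diag, Matrix.mul_apply, Matrix.transpose_apply]
    refine Finset.sum_congr rfl fun k _ => ?_
    rw [PiLp.inner_apply]
    refine Finset.sum_congr rfl fun i _ => ?_
    simp [hT, hR, Matrix.toLpLin_apply, mul_comm]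
  rw [h2, h1 (rightSingularBasis T), Finset.sum_mul]
  have h3 : ∑ j ∈ Finset.range n, singVal X j * schattenInfNorm B =
      ∑ j : Fin (finrank ℝ (EuclideanSpace ℝ (Fin n))), singVal X j * schattenInfNorm B := by
    rw [← Finset.sum_range fun i => singVal X i * schattenInfNorm B, finrank_euclideanSpace_fin]
  rw [h3]
  refine Finset.sum_le_sum fun k _ => (real_inner_le_norm _ _).trans ?_
  rw [norm_apply_rightSingularBasis]
  refine mul_le_mul_of_nonneg_left ?_ (singVal_nonneg X k)
  have h4 := (LinearMap.toContinuousLinearMap R).le_opNorm (rightSingularBasis T k)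
  rwa [(rightSingularBasis T).norm_eq_one, mul_one] at h4

theorem schattenInfNorm_nonneg (B : Matrix (Fin m) (Fin n) ℝ) : 0 ≤ schattenInfNorm B :=
  norm_nonneg _

theorem schattenInfNorm_sub_le (B B' : Matrix (Fin m) (Fin n) ℝ) :
    schattenInfNorm (B - B') ≤ schattenInfNorm B + schattenInfNorm B' := by
  unfold schattenInfNorm
  rw [map_sub, map_sub]
  exact norm_sub_le _ _

theorem adj_sub (A : Matrix (Fin m) (Fin n) ℝ →ₗ[ℝ] (Fin L → ℝ)) (z w : Fin L → ℝ) :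
    adj A (z - w) = adj A z - adj A w := by
  ext i j
  simp [adj, mul_sub, Finset.sum_sub_distrib]

theorem lqNorm_nonneg (q : ℝ) (z : Fin L → ℝ) : 0 ≤ lqNorm q z :=
  Real.rpow_nonneg (Finset.sum_nonneg fun _ _ => Real.rpow_nonneg (abs_nonneg _) _) _

theorem lqNorm_rpow {q : ℝ} (hq : 0 < q) (z : Fin L → ℝ) : lqNorm q z ^ q = ∑ l, |z l| ^ q := by
  rw [lqNorm, ← Real.rpow_mul (Finset.sum_nonneg fun _ _ => Real.rpow_nonneg (abs_nonneg _) _),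
    one_div_mul_cancel hq.ne', Real.rpow_one]

theorem lqNorm_rpow_sub_le {q : ℝ} (hq : 0 < q) (hq1 : q ≤ 1) (z w : Fin L → ℝ) :
    lqNorm q (z - w) ^ q ≤ lqNorm q z ^ q + lqNorm q w ^ q := by
  rw [lqNorm_rpow hq, lqNorm_rpow hq, lqNorm_rpow hq, ← Finset.sum_add_distrib]
  refine Finset.sum_le_sum fun l _ => ?_
  refine (Real.rpow_le_rpow (abs_nonneg _) (abs_sub (z l) (w l)) hq.le).trans ?_
  exact Real.rpow_add_le_add_rpow (abs_nonneg _) (abs_nonneg _) hq.le hq1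

theorem lqNorm_rpow_sum_le {ι : Type*} {q : ℝ} (hq : 0 < q) (hq1 : q ≤ 1) (J : Finset ι)
    (z : ι → Fin L → ℝ) : lqNorm q (∑ j ∈ J, z j) ^ q ≤ ∑ j ∈ J, lqNorm q (z j) ^ q := by
  simp only [lqNorm_rpow hq]
  rw [Finset.sum_comm]
  refine Finset.sum_le_sum fun l _ => ?_
  rw [Finset.sum_apply]
  refine (Real.rpow_le_rpow (abs_nonneg _) (Finset.abs_sum_le_sum_abs _ _) hq.le).trans ?_
  exact rpow_sum_le_sum_rpow J (fun j => |z j l|) (fun j => abs_nonneg _) hq hq1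

end Matrices

/-! ### Restricted bounds, block estimates and noise. -/

section Measurements

variable {m n L : ℕ} {A : Matrix (Fin m) (Fin n) ℝ →ₗ[ℝ] (Fin L → ℝ)} {q C₁ C₂ : ℝ}

theorem schattenNorm_zero {p : ℝ} (hp : 0 < p) :
    schattenNorm p (0 : Matrix (Fin m) (Fin n) ℝ) = 0 := by
  simp [schattenNorm, singVal, Real.zero_rpow hp.ne', Real.zero_rpow (inv_ne_zero hp.ne')]

theorem LqRUB.bounds {t : ℕ} (hA : LqRUB A q t C₁ C₂) (hq : 0 < q)
    (X : Matrix (Fin m) (Fin n) ℝ) (hX : X.rank ≤ t) :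
    C₁ * schattenNorm 2 X ^ q ≤ lqNorm q (A X) ^ q / L ∧
      lqNorm q (A X) ^ q / L ≤ C₂ * schattenNorm 2 X ^ q := by
  by_cases h : X = 0
  · have h1 : lqNorm q (A X) ^ q = 0 := by
      rw [lqNorm_rpow hq, h]
      simp [Real.zero_rpow hq.ne']
    rw [h1, h, schattenNorm_zero two_pos, Real.zero_rpow hq.ne']
    simp
  · exact hA X h hX

/-- The constants of a restricted uniform bound are ordered and there is a measurement, unless
there is no nonzero matrix. -/
theorem LqRUB.le_and_pos_or_singVal_eq_zero {t : ℕ} (ht : 0 < t) (hA : LqRUB A q t C₁ C₂)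
    (hq : 0 < q) (hC₁ : 0 < C₁) :
    (C₁ ≤ C₂ ∧ 0 < L) ∨ ∀ (Y : Matrix (Fin m) (Fin n) ℝ) (j : ℕ), singVal Y j = 0 := by
  by_contra! h
  obtain ⟨h1, Y, j, hj⟩ := h
  have h0 : 0 < singVal Y 0 := by
    have h2 := singVal_antitone Y (Nat.zero_le j)
    have h3 := (singVal_nonneg Y j).lt_of_ne' hj
    linarith
  -- The leading singular component is a nonzero test matrix of rank at most 1, which is within the
  -- order t.
  have h4 := hA.bounds hq (svdPart Y {0}) ((rank_svdPart_le _ _).trans (by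
      rw [Finset.card_singleton]
      exact ht))
  have h5 : 0 < schattenNorm 2 (svdPart Y {0}) ^ q := by
    rw [schattenNorm_two_svdPart_rpow, Finset.sum_singleton]
    positivity
  rcases Nat.eq_zero_or_pos L with hL | hL
  · have h6 := h4.1
    have h7 : lqNorm q (A (svdPart Y {0})) ^ q / (L : ℝ) = 0 := by
      rw [Nat.cast_eq_zero.2 hL, div_zero]
    rw [h7] at h6
    nlinarith
  · have h6 : C₂ < C₁ := by
      by_contra hc
      exact absurd (h1 (not_lt.1 hc)) (by omega)
    have h7 := h4.1.trans h4.2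
    have h8 := le_of_mul_le_mul_right h7 h5
    linarith

theorem svdPart_range_add_mul (X : Matrix (Fin m) (Fin n) ℝ) (M s K : ℕ) :
    svdPart X (Finset.range (M + K * s)) = svdPart X (Finset.range M) +
      ∑ j ∈ Finset.range K, svdPart X (Finset.Ico (M + j * s) (M + j * s + s)) := by
  induction K with
  | zero => simp
  | succ K ih =>
    have h : Finset.range (M + (K + 1) * s) =
        Finset.range (M + K * s) ∪ Finset.Ico (M + K * s) (M + K * s + s) := by
      rw [Finset.range_eq_Ico, Finset.range_eq_Ico,
        Finset.Ico_union_Ico_eq_Ico (Nat.zero_le _) (Nat.le_add_right _ _)]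
      congr 1
      ring
    have hd : Disjoint (Finset.range (M + K * s)) (Finset.Ico (M + K * s) (M + K * s + s)) := by
      rw [Finset.range_eq_Ico]
      exact Finset.Ico_disjoint_Ico_consecutive _ _ _
    rw [h, svdPart_union X hd, ih, Finset.sum_range_succ, add_assoc]

/-- The estimates on the blocks of the error of a Schatten-`p` minimization: `a` is the norm of the
leading `r + s` singular components, `S` the sum of the norms of the other blocks, `H₀` and `W` the
`p`-th powers of the quasi-norms of the leading `r` components and of the rest. -/
theorem exists_block_estimates {r s : ℕ} (hr : 0 < r) (hs : 0 < s) {p : ℝ} (hp : 0 < p)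
    (hpq : p ≤ q) (hq1 : q ≤ 1) (hA : LqRUB A q (r + s) C₁ C₂)
    {X Xhat Xr : Matrix (Fin m) (Fin n) ℝ} (hXr : Xr.rank ≤ r)
    (hmin : schattenNorm p Xhat ^ p ≤ schattenNorm p X ^ p) :
    ∃ a S H₀ W : ℝ, 0 ≤ a ∧ 0 ≤ S ∧ 0 ≤ H₀ ∧ 0 ≤ W ∧
      schattenNorm 2 (Xhat - X) ^ q ≤ a + S ∧
      C₁ * a ≤ lqNorm q (A (Xhat - X)) ^ q / L + C₂ * S ∧
      S ≤ (s : ℝ) ^ (-((1 / p - 1 / 2) * q)) * W ^ (q / p) ∧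
      W ≤ H₀ + 2 * schattenNorm p (X - Xr) ^ p ∧
      H₀ ^ (q / p) ≤ (r : ℝ) ^ ((1 / p - 1 / 2) * q) * a ∧
      (∑ j ∈ Finset.range n, singVal (Xhat - X) j) ^ q ≤ (H₀ + W) ^ (q / p) := by
  have hq : 0 < q := hp.trans_le hpq
  have hp1 : p ≤ 1 := hpq.trans hq1
  set H := Xhat - X with hH
  set h := singVal H with hh
  have h0 : ∀ i, 0 ≤ h i := singVal_nonneg H
  -- Since s ≥ 1, this many blocks after the head exhaust the singular values.
  set K := min m n with hK
  set N := r + s + K * s with hN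
  have hKs : K ≤ K * s := Nat.le_mul_of_pos_right K hs
  have hKN : min m n ≤ N := by omega
  have hsplit := svdPart_range_add_mul H (r + s) s K
  rw [svdPart_range H hKN] at hsplit
  set B : ℕ → Matrix (Fin m) (Fin n) ℝ :=
    fun j => svdPart H (Finset.Ico (r + s + j * s) (r + s + j * s + s)) with hB
  have hBnorm : ∀ j, schattenNorm 2 (B j) ^ q =
      (∑ i ∈ Finset.range s, h (r + (s + (j * s + i))) ^ 2) ^ (q / 2) := by
    intro j
    rw [hB, schattenNorm_two_svdPart_rpow, Finset.sum_Ico_eq_sum_range, Nat.add_sub_cancel_left]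
    simp only [add_assoc, hh]
  have hBrank : ∀ j, (B j).rank ≤ r + s := by
    intro j
    refine (rank_svdPart_le _ _).trans ?_
    rw [Nat.card_Ico]
    omega
  have hpow : ∀ i, 0 ≤ h i ^ p := fun i => Real.rpow_nonneg (h0 i) p
  have hrN : r + (s + K * s) = N := by omega
  refine ⟨schattenNorm 2 (svdPart H (Finset.range (r + s))) ^ q,
    ∑ j ∈ Finset.range K, schattenNorm 2 (B j) ^ q, ∑ i ∈ Finset.range r, h i ^ p,
    ∑ i ∈ Finset.range (s + K * s), h (r + i) ^ p, Real.rpow_nonneg (schattenNorm_nonneg _ _) _,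
    Finset.sum_nonneg fun j _ => Real.rpow_nonneg (schattenNorm_nonneg _ _) _,
    Finset.sum_nonneg fun i _ => hpow i, Finset.sum_nonneg fun i _ => hpow _, ?_, ?_, ?_, ?_, ?_,
    ?_⟩
  · rw [schattenNorm_two_rpow q H hKN, schattenNorm_two_svdPart_rpow, hN, Finset.sum_range_add]
    refine (Real.rpow_add_le_add_rpow (Finset.sum_nonneg fun _ _ => sq_nonneg _)
      (Finset.sum_nonneg fun _ _ => sq_nonneg _) (by positivity) (by linarith)).trans ?_
    refine add_le_add_right ?_ _
    rw [sum_range_mul_eq fun i => singVal H (r + s + i) ^ 2]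
    refine (rpow_sum_le_sum_rpow _ _ (fun j => Finset.sum_nonneg fun _ _ => sq_nonneg _)
      (by positivity) (by linarith)).trans (le_of_eq ?_)
    refine Finset.sum_congr rfl fun j _ => ?_
    rw [hBnorm]
    simp only [add_assoc, hh]
  · refine (hA.bounds hq _ ((rank_svdPart_le _ _).trans (by rw [Finset.card_range]))).1.trans ?_
    have e1 : A (svdPart H (Finset.range (r + s))) = A H - ∑ j ∈ Finset.range K, A (B j) := by
      conv_rhs => rw [hsplit]
      rw [map_add, map_sum, add_sub_cancel_right]
    have e2 : lqNorm q (A (svdPart H (Finset.range (r + s)))) ^ q ≤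
        lqNorm q (A H) ^ q + ∑ j ∈ Finset.range K, lqNorm q (A (B j)) ^ q := by
      rw [e1]
      refine (lqNorm_rpow_sub_le hq hq1 _ _).trans ?_
      exact add_le_add_right (lqNorm_rpow_sum_le hq hq1 _ _) _
    refine (div_le_div_of_nonneg_right e2 (Nat.cast_nonneg L)).trans ?_
    rw [add_div, Finset.sum_div, Finset.mul_sum]
    exact add_le_add_right (Finset.sum_le_sum fun j _ => (hA.bounds hq _ (hBrank j)).2) _
  · simp only [hBnorm]
    -- The sequence starts after the leading r values, so its own first block lies in the head and
    -- the later ones are the B j.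
    exact sum_block_rpow_le (g := fun i => h (r + i))
      (fun i j hij => singVal_antitone H (Nat.add_le_add_left hij r)) (fun i => h0 _) hp hpq hs K
  · have hmn : min (finrank ℝ (EuclideanSpace ℝ (Fin n))) (finrank ℝ (EuclideanSpace ℝ (Fin m))) ≤
        r + (s + K * s) := by
      rw [finrank_euclideanSpace_fin, finrank_euclideanSpace_fin, min_comm]
      omega
    have h1 := sum_tail_singularValues_rpow_le (Matrix.toEuclideanLin X) (Matrix.toEuclideanLin H)
      hp hp1 hmn (by
        rw [← map_add, hH, add_sub_cancel, hrN]
        rwa [schattenNorm_rpow hp Xhat hKN, schattenNorm_rpow hp X hKN] at hmin)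
    refine h1.trans ?_
    refine add_le_add_right (mul_le_mul_of_nonneg_left ?_ zero_le_two) _
    rw [schattenNorm_rpow hp (X - Xr) (N := s + K * s) (by omega)]
    exact Finset.sum_le_sum fun i _ => Real.rpow_le_rpow (singVal_nonneg _ _)
      (singVal_add_le_of_rank_le X Xr hXr i) hp.le
  · have h1 := sum_rpow_le_card_mul_rpow (Finset.range r) h h0 hp (by linarith)
    have h2 := Real.rpow_le_rpow (Finset.sum_nonneg fun i _ => hpow i) h1
      (by positivity : 0 ≤ q / p)
    have h3 : 0 ≤ ∑ i ∈ Finset.range r, h i ^ 2 := Finset.sum_nonneg fun _ _ => sq_nonneg _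
    rw [Finset.card_range, Real.mul_rpow (by positivity) (by positivity),
      ← Real.rpow_mul (Nat.cast_nonneg r), ← Real.rpow_mul h3,
      show (1 - p / 2) * (q / p) = (1 / p - 1 / 2) * q by field_simp,
      show p / 2 * (q / p) = q / 2 by field_simp] at h2
    refine h2.trans (mul_le_mul_of_nonneg_left ?_ (by positivity))
    rw [schattenNorm_two_svdPart_rpow]
    refine Real.rpow_le_rpow h3 ?_ (by positivity)
    exact Finset.sum_le_sum_of_subset_of_nonneg
      (Finset.range_subset_range.2 (Nat.le_add_right r s)) fun _ _ _ => sq_nonneg _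
  · have h1 : ∑ j ∈ Finset.range n, h j ≤ (∑ j ∈ Finset.range n, h j ^ p) ^ (1 / p) := by
      have h2 := sum_rpow_le_rpow_sum (Finset.range n) (fun j => h j ^ p) hpow (c := 1 / p)
        (by rwa [le_div_iff₀ hp, one_mul])
      refine le_trans (le_of_eq (Finset.sum_congr rfl fun j _ => ?_)) h2
      rw [← Real.rpow_mul (h0 j), mul_one_div_cancel hp.ne', Real.rpow_one]
    have h3 := Real.rpow_le_rpow (Finset.sum_nonneg fun j _ => h0 j) h1 hq.le
    rw [← Real.rpow_mul (Finset.sum_nonneg fun j _ => hpow j),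
      show 1 / p * q = q / p by ring] at h3
    refine h3.trans (le_of_eq ?_)
    rw [← Finset.sum_range_add (fun i => h i ^ p), hrN, ← schattenNorm_rpow hp H hKN,
      ← schattenNorm_rpow hp H (min_le_right m n)]

theorem lqNorm_rpow_div_le_of_mem_lqBall (hq : 0 < q) (hq1 : q ≤ 1) {η : ℝ} {b : Fin L → ℝ}
    {X Xhat : Matrix (Fin m) (Fin n) ℝ} (hL : 0 < L) (hX : b - A X ∈ lqBall L q η)
    (hXhat : b - A Xhat ∈ lqBall L q η) :
    lqNorm q (A (Xhat - X)) ^ q / L ≤ 2 * η ^ q / (L : ℝ) ^ (1 - q) := by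
  have hL' : (0 : ℝ) < L := Nat.cast_pos.2 hL
  have key : ∀ z : Fin L → ℝ, z ∈ lqBall L q η → lqNorm q z ^ q ≤ (L : ℝ) ^ q * η ^ q := by
    intro z hz
    have h1 : lqNorm q z / L ≤ η := hz
    have h2 : 0 ≤ η := (div_nonneg (lqNorm_nonneg q z) hL'.le).trans h1
    rw [← Real.mul_rpow hL'.le h2]
    refine Real.rpow_le_rpow (lqNorm_nonneg q z) ?_ hq.le
    rw [div_le_iff₀ hL'] at h1
    linarith
  have h1 : A (Xhat - X) = (b - A X) - (b - A Xhat) := by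
    rw [map_sub]
    abel
  have h2 := lqNorm_rpow_sub_le hq hq1 (b - A X) (b - A Xhat)
  rw [← h1] at h2
  have h3 := key _ hX
  have h4 := key _ hXhat
  rw [Real.rpow_sub hL', Real.rpow_one, div_div_eq_mul_div]
  refine div_le_div_of_nonneg_right ?_ hL'.le
  linarith

/-- With H the error, ‖𝒜H‖₂² = ⟪H, 𝒜*𝒜H⟫ is at most 2η times the trace norm of H, since 𝒜H is a
difference of two feasible residuals. Hölder then passes from ℓ_2 to ℓ_q, which produces the power
of L. -/
theorem lqNorm_rpow_div_sq_le_of_mem_dantzigBall (hq : 0 < q) (hq1 : q ≤ 1) {η : ℝ}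
    {b : Fin L → ℝ} {X Xhat : Matrix (Fin m) (Fin n) ℝ} (hL : 0 < L)
    (hX : b - A X ∈ dantzigBall A η) (hXhat : b - A Xhat ∈ dantzigBall A η) :
    (lqNorm q (A (Xhat - X)) ^ q / L) ^ 2 ≤
      2 ^ q * η ^ q / (L : ℝ) ^ q * (∑ j ∈ Finset.range n, singVal (Xhat - X) j) ^ q := by
  have hL' : (0 : ℝ) < L := Nat.cast_pos.2 hL
  have hη : 0 ≤ η := (schattenInfNorm_nonneg _).trans hX
  set H := Xhat - X with hH
  set σ := ∑ j ∈ Finset.range n, singVal H j with hσ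
  have hσ0 : 0 ≤ σ := Finset.sum_nonneg fun j _ => singVal_nonneg H j
  have h1 : A H = (b - A X) - (b - A Xhat) := by
    rw [hH, map_sub]
    abel
  have h2 : schattenInfNorm (adj A (A H)) ≤ 2 * η := by
    rw [h1, adj_sub]
    refine (schattenInfNorm_sub_le _ _).trans ?_
    have h3 : schattenInfNorm (adj A (b - A X)) ≤ η := hX
    have h4 : schattenInfNorm (adj A (b - A Xhat)) ≤ η := hXhat
    linarith
  have h3 : ∑ l, |A H l| ^ 2 ≤ 2 * η * σ := by
    have h4 := trace_transpose_mul_le H (adj A (A H))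
    rw [trace_transpose_mul_adj] at h4
    calc ∑ l, |A H l| ^ 2 = ∑ l, A H l * A H l :=
          Finset.sum_congr rfl fun l _ => by rw [sq_abs, sq]
      _ ≤ σ * schattenInfNorm (adj A (A H)) := h4
      _ ≤ σ * (2 * η) := mul_le_mul_of_nonneg_left h2 hσ0
      _ = 2 * η * σ := mul_comm _ _
  have h5 := sum_rpow_le_card_mul_rpow Finset.univ (fun l => |A H l|) (fun l => abs_nonneg _) hq
    (by linarith)
  have h0 : 0 ≤ ∑ l, |A H l| ^ 2 := Finset.sum_nonneg fun l _ => sq_nonneg _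
  rw [Finset.card_univ, Fintype.card_fin, ← lqNorm_rpow hq] at h5
  have h6 : (lqNorm q (A H) ^ q) ^ 2 ≤
      (((L : ℝ) ^ (1 - q / 2)) * (∑ l, |A H l| ^ 2) ^ (q / 2)) ^ 2 :=
    pow_le_pow_left₀ (Real.rpow_nonneg (lqNorm_nonneg _ _) _) h5 2
  have h7 : ((∑ l, |A H l| ^ 2) ^ (q / 2)) ^ 2 ≤ 2 ^ q * η ^ q * σ ^ q := by
    rw [← Real.rpow_two, ← Real.rpow_mul h0, div_mul_cancel₀ q two_ne_zero,
      ← Real.mul_rpow zero_le_two hη, ← Real.mul_rpow (by positivity) hσ0]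
    exact Real.rpow_le_rpow h0 h3 hq.le
  have h8 : ((L : ℝ) ^ (1 - q / 2)) ^ 2 = (L : ℝ) ^ 2 / (L : ℝ) ^ q := by
    rw [← Real.rpow_two, ← Real.rpow_mul hL'.le, ← Real.rpow_two, ← Real.rpow_sub hL']
    congr 1
    ring
  rw [mul_pow, h8] at h6
  rw [div_pow, div_le_iff₀ (by positivity)]
  refine h6.trans ((mul_le_mul_of_nonneg_left h7 (by positivity)).trans (le_of_eq ?_))
  ring

end Measurements

/-! ### Solving the scalar inequalities for the error. -/

section Arithmetic

theorem add_rpow_le_two_rpow_mul {x y c : ℝ} (hx : 0 ≤ x) (hy : 0 ≤ y) (hc : 1 ≤ c) :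
    (x + y) ^ c ≤ 2 ^ (c - 1) * (x ^ c + y ^ c) := by
  have h := Real.rpow_sum_le_const_mul_sum_rpow_of_nonneg (s := (Finset.univ : Finset (Fin 2)))
    (f := ![x, y]) hc (by
      intro i _
      fin_cases i
      · exact hx
      · exact hy)
  simpa using h

variable {a S y C₁ C₂ ρ κ α β τ h D Y : ℝ}

/-- Absorbing S gives ρa ≤ y; with y² ≤ Da one factor a cancels. -/
theorem error_le_of_sq_le (hκ : 0 ≤ κ) (hC₂ : 0 ≤ C₂) (ha : 0 ≤ a) (hD : 0 ≤ D)
    (hρ : ρ = C₁ - C₂ * κ) (hρ0 : 0 < ρ) (hS : S ≤ κ * a) (hh : h ≤ a + S)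
    (hy : C₁ * a ≤ y + C₂ * S) (hyD : y ^ 2 ≤ D * a) : h ≤ D / ρ ^ 2 * (κ + 1) := by
  have h1 : ρ * a ≤ y := by
    have := mul_le_mul_of_nonneg_left hS hC₂
    rw [hρ]
    linarith
  have h2 : a ≤ D / ρ ^ 2 := by
    rw [le_div_iff₀ (by positivity)]
    rcases ha.eq_or_lt with rfl | ha'
    · simpa using hD
    · have h3 := (pow_le_pow_left₀ (by positivity) h1 2).trans hyD
      refine le_of_mul_le_mul_right ?_ ha'
      linarith
  have h3 := mul_le_mul_of_nonneg_right h2 (by linarith : 0 ≤ κ + 1)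
  linarith

theorem error_le_of_le (hκ : 0 ≤ κ) (hC₂ : 0 ≤ C₂) (hρ : ρ = C₁ - C₂ * κ)
    (hρ0 : 0 < ρ) (hS : S ≤ κ * a) (hh : h ≤ a + S) (hy : C₁ * a ≤ y + C₂ * S) (hyY : y ≤ Y) :
    h ≤ Y / ρ * (κ + 1) := by
  have h1 : a ≤ Y / ρ := by
    rw [le_div_iff₀ hρ0, hρ]
    have := mul_le_mul_of_nonneg_left hS hC₂
    linarith
  have h3 := mul_le_mul_of_nonneg_right h1 (by linarith : 0 ≤ κ + 1)
  linarith

/-- Solving for a leaves the τ-coefficient C₂β/ρ·(α + 1) + β; α ≤ β allows the factored form. -/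
theorem error_le_of_le_of_tail (hα : 0 ≤ α) (hαβ : α ≤ β) (hτ : 0 ≤ τ) (hC₂ : 0 ≤ C₂)
    (hρ : ρ = C₁ - C₂ * α) (hρ0 : 0 < ρ) (hS : S ≤ α * a + β * τ) (hh : h ≤ a + S)
    (hy : C₁ * a ≤ y + C₂ * S) (hyY : y ≤ Y) :
    h ≤ (C₂ * β / ρ + 1) * (β + 1) * τ + Y / ρ * (α + 1) := by
  have h1 : a ≤ Y / ρ + C₂ * β / ρ * τ := by
    have e : Y / ρ + C₂ * β / ρ * τ = (Y + C₂ * β * τ) / ρ := by ring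
    rw [e, le_div_iff₀ hρ0, hρ]
    have := mul_le_mul_of_nonneg_left hS hC₂
    linarith
  have hβ : 0 ≤ β := hα.trans hαβ
  have hc : 0 ≤ C₂ * β / ρ := by positivity
  set c := C₂ * β / ρ
  have h3 := mul_le_mul_of_nonneg_right h1 (by linarith : 0 ≤ α + 1)
  have h4 : 0 ≤ c * (β - α) * τ := mul_nonneg (mul_nonneg hc (by linarith)) hτ
  linarith

/-- The tail prevents cancelling a, so the arithmetic–geometric mean inequality splits the root of
(D/ρ)·ρ(a + τ), and half of ρa is absorbed on the left. The constant 3/2 comes from 2α ≤ β; the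
factor 4 has slack. -/
theorem error_le_of_sq_le_of_tail (hα : 0 ≤ α) (hαβ : 2 * α ≤ β) (hτ : 0 ≤ τ) (ha : 0 ≤ a)
    (hC₂ : 0 ≤ C₂) (hD : 0 ≤ D) (hρ : ρ = C₁ - C₂ * α) (hρ0 : 0 < ρ) (hS : S ≤ α * a + β * τ)
    (hh : h ≤ a + S) (hy : C₁ * a ≤ y + C₂ * S) (hyD : y ^ 2 ≤ D * (a + τ)) :
    h ≤ (2 * (C₂ * β / ρ) + 3 / 2) * (β + 1) * τ + 4 * (D / ρ ^ 2) * (α + 1) := by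
  have hβ : 0 ≤ β := by linarith
  have h0 : y ≤ (D / ρ + ρ * (a + τ)) / 2 := by
    refine le_of_sq_le_sq ?_ (by positivity)
    have e : D * (a + τ) = D / ρ * (ρ * (a + τ)) := by field_simp
    rw [e] at hyD
    nlinarith [sq_nonneg (D / ρ - ρ * (a + τ))]
  have h1 : a ≤ D / ρ ^ 2 + τ + 2 * (C₂ * β / ρ) * τ := by
    have e : D / ρ ^ 2 + τ + 2 * (C₂ * β / ρ) * τ = (D / ρ + ρ * τ + 2 * (C₂ * β * τ)) / ρ := by
      field_simp
    rw [e, le_div_iff₀ hρ0]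
    have h2 := mul_le_mul_of_nonneg_left hS hC₂
    have h3 : ρ * a = C₁ * a - C₂ * α * a := by rw [hρ]; ring
    linarith
  have hc : 0 ≤ C₂ * β / ρ := by positivity
  have hd : 0 ≤ D / ρ ^ 2 := by positivity
  set c := C₂ * β / ρ
  set d := D / ρ ^ 2
  have h3 := mul_le_mul_of_nonneg_right h1 (by linarith : 0 ≤ α + 1)
  have h4 : 0 ≤ c * (β - α) * τ := mul_nonneg (mul_nonneg hc (by linarith)) hτ
  have h5 : 0 ≤ (β - 2 * α) * τ := mul_nonneg (by linarith) hτ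
  have h6 : 0 ≤ d * (α + 1) := mul_nonneg hd (by linarith)
  linarith

end Arithmetic

/-! ### Block estimates with the constants of the theorem. -/

section ErrorBounds

variable {m n L : ℕ} {A : Matrix (Fin m) (Fin n) ℝ →ₗ[ℝ] (Fin L → ℝ)} {r s : ℕ} {k p q : ℝ}
  {C₁ C₂ κ : ℝ} {X Xhat Xr : Matrix (Fin m) (Fin n) ℝ}

/-- κ is the product of the r-power from comparing ℓ_p with ℓ_2 on the head and the s-power from the
blocks. -/
theorem inv_rpow_eq_mul (hr : 0 < r) (hs : 0 < s) (hks : k * r = s) (θ : ℝ) :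
    (1 / k) ^ θ = (r : ℝ) ^ θ * (s : ℝ) ^ (-θ) := by
  have hr' : (0 : ℝ) < r := Nat.cast_pos.2 hr
  have hs' : (0 : ℝ) < s := Nat.cast_pos.2 hs
  have hk : 1 / k = r / s := by
    rw [← hks, div_mul_cancel_right₀ hr'.ne', one_div]
  rw [hk, Real.div_rpow hr'.le hs'.le, Real.rpow_neg hs'.le, div_eq_mul_inv]

theorem schattenNorm_eq_zero_of_singVal_eq_zero {t : ℝ} (ht : 0 < t)
    {Y : Matrix (Fin m) (Fin n) ℝ} (hY : ∀ j, singVal Y j = 0) : schattenNorm t Y = 0 := by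
  simp [schattenNorm, hY, Real.zero_rpow ht.ne', Real.zero_rpow (inv_ne_zero ht.ne')]

theorem nonneg_of_mem_lqBall {η : ℝ} {z : Fin L → ℝ} (hz : z ∈ lqBall L q η) : 0 ≤ η :=
  (div_nonneg (lqNorm_nonneg q z) (Nat.cast_nonneg L)).trans hz

theorem nonneg_of_mem_dantzigBall {η : ℝ} {z : Fin L → ℝ} (hz : z ∈ dantzigBall A η) : 0 ≤ η :=
  (schattenInfNorm_nonneg _).trans hz

theorem exists_estimates_of_rank_le (hr : 0 < r) (hs : 0 < s) (hks : k * r = s) (hp : 0 < p)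
    (hpq : p ≤ q) (hq1 : q ≤ 1) (hA : LqRUB A q (r + s) C₁ C₂)
    (hκ : κ = (1 / k) ^ ((1 / p - 1 / 2) * q)) (hX : X.rank ≤ r)
    (hmin : schattenNorm p Xhat ^ p ≤ schattenNorm p X ^ p) :
    ∃ a S : ℝ, 0 ≤ a ∧ schattenNorm 2 (Xhat - X) ^ q ≤ a + S ∧
      C₁ * a ≤ lqNorm q (A (Xhat - X)) ^ q / L + C₂ * S ∧ S ≤ κ * a ∧
      (∑ j ∈ Finset.range n, singVal (Xhat - X) j) ^ q ≤
        2 ^ (q / p) * (r : ℝ) ^ ((1 / p - 1 / 2) * q) * a := by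
  obtain ⟨a, S, H₀, W, ha, -, hH₀, hW, h1, h2, h3, h4, h5, h6⟩ :=
    exists_block_estimates hr hs hp hpq hq1 hA hX hmin
  have hqp : 0 ≤ q / p := div_nonneg (hp.le.trans hpq) hp.le
  -- X serves as its own approximation, so the tail term vanishes.
  rw [sub_self, schattenNorm_zero hp, Real.zero_rpow hp.ne', mul_zero, add_zero] at h4
  refine ⟨a, S, ha, h1, h2, h3.trans ?_, h6.trans ?_⟩
  · rw [hκ, inv_rpow_eq_mul hr hs hks]
    have h7 := mul_le_mul_of_nonneg_left ((Real.rpow_le_rpow hW h4 hqp).trans h5)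
      (by positivity : 0 ≤ (s : ℝ) ^ (-((1 / p - 1 / 2) * q)))
    linarith
  · rw [mul_assoc]
    refine le_trans (Real.rpow_le_rpow (by positivity) (by linarith : H₀ + W ≤ 2 * H₀) hqp) ?_
    rw [Real.mul_rpow zero_le_two hH₀]
    exact mul_le_mul_of_nonneg_left h5 (by positivity)

theorem exists_estimates (hr : 0 < r) (hs : 0 < s) (hks : k * r = s) (hp : 0 < p)
    (hpq : p ≤ q) (hq1 : q ≤ 1) (hA : LqRUB A q (r + s) C₁ C₂)
    (hκ : κ = (1 / k) ^ ((1 / p - 1 / 2) * q)) (hXr : Xr.rank ≤ r)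
    (hmin : schattenNorm p Xhat ^ p ≤ schattenNorm p X ^ p) :
    ∃ a S : ℝ, 0 ≤ a ∧ schattenNorm 2 (Xhat - X) ^ q ≤ a + S ∧
      C₁ * a ≤ lqNorm q (A (Xhat - X)) ^ q / L + C₂ * S ∧
      S ≤ 2 ^ (q / p - 1) * κ * a + 2 ^ (2 * q / p - 1) * κ *
        (schattenNorm p (X - Xr) / (r : ℝ) ^ (1 / p - 1 / 2)) ^ q ∧
      (∑ j ∈ Finset.range n, singVal (Xhat - X) j) ^ q ≤
        2 ^ (2 * q / p - 1) * (r : ℝ) ^ ((1 / p - 1 / 2) * q) *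
          (a + (schattenNorm p (X - Xr) / (r : ℝ) ^ (1 / p - 1 / 2)) ^ q) := by
  obtain ⟨a, S, H₀, W, ha, -, hH₀, hW, h1, h2, h3, h4, h5, h6⟩ :=
    exists_block_estimates hr hs hp hpq hq1 hA hXr hmin
  have hqp : 1 ≤ q / p := by rwa [le_div_iff₀ hp, one_mul]
  have hqp0 : 0 ≤ q / p := zero_le_one.trans hqp
  have hr' : (0 : ℝ) < r := Nat.cast_pos.2 hr
  set T := schattenNorm p (X - Xr) with hT
  have hT0 : 0 ≤ T := schattenNorm_nonneg _ _
  have hTp : 0 ≤ T ^ p := Real.rpow_nonneg hT0 p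
  set R := (r : ℝ) ^ ((1 / p - 1 / 2) * q) with hR
  have hR0 : 0 < R := Real.rpow_pos_of_pos hr' _
  set τ := (T / (r : ℝ) ^ (1 / p - 1 / 2)) ^ q with hτ
  have hTq : (T ^ p) ^ (q / p) = R * τ := by
    rw [← Real.rpow_mul hT0, mul_div_cancel₀ q hp.ne', hτ,
      Real.div_rpow hT0 (by positivity), ← Real.rpow_mul hr'.le, ← hR]
    field_simp
  -- One factor is from convexity of x^(q/p). The other comes from the doubled tail in the bound on
  -- W, and below from H₀ + W ≤ 2(H₀ + T^p).
  have e1 : (2 : ℝ) ^ (q / p - 1) * 2 ^ (q / p) = 2 ^ (2 * q / p - 1) := by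
    rw [← Real.rpow_add two_pos]
    congr 1
    ring
  refine ⟨a, S, ha, h1, h2, h3.trans ?_, h6.trans ?_⟩
  · have h7 : W ^ (q / p) ≤ 2 ^ (q / p - 1) * (R * a) + 2 ^ (2 * q / p - 1) * (R * τ) := by
      refine (Real.rpow_le_rpow hW h4 hqp0).trans ?_
      refine (add_rpow_le_two_rpow_mul hH₀ (by positivity) hqp).trans ?_
      rw [Real.mul_rpow zero_le_two hTp, hTq, mul_add, ← e1, mul_assoc]
      exact add_le_add_left (mul_le_mul_of_nonneg_left h5 (by positivity)) _
    rw [hκ, inv_rpow_eq_mul hr hs hks, ← hR]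
    have h8 := mul_le_mul_of_nonneg_left h7
      (by positivity : 0 ≤ (s : ℝ) ^ (-((1 / p - 1 / 2) * q)))
    linarith
  · refine le_trans (Real.rpow_le_rpow (by positivity)
      (by linarith : H₀ + W ≤ 2 * (H₀ + T ^ p)) hqp0) ?_
    rw [Real.mul_rpow zero_le_two (by positivity), ← e1]
    have h7 := add_rpow_le_two_rpow_mul hH₀ hTp hqp
    rw [hTq] at h7
    have h8 : (H₀ + T ^ p) ^ (q / p) ≤ 2 ^ (q / p - 1) * (R * a + R * τ) :=
      h7.trans (mul_le_mul_of_nonneg_left (by linarith) (by positivity))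
    have h9 := mul_le_mul_of_nonneg_left h8 (by positivity : 0 ≤ (2 : ℝ) ^ (q / p))
    linarith

end ErrorBounds

end MatrixRecovery

/-! ### The recovery theorem. -/

theorem mainTheorem2 {m n L : ℕ} (A : Matrix (Fin m) (Fin n) ℝ →ₗ[ℝ] (Fin L → ℝ))
    (r s : ℕ) (hr : 0 < r) (k : ℝ) (hks : k * r = s)
    (p q : ℝ) (hp : 0 < p) (hpq : p ≤ q) (hq : q ≤ 1)
    (C₁ C₂ : ℝ) (hC₁ : 0 < C₁)
    -- the order `r + s` is `(k + 1) r`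
    (hA : MatrixRecovery.LqRUB A q (r + s) C₁ C₂)
    (κ ρ₁ ρ₂ : ℝ)
    (hκ : κ = (1 / k) ^ ((1 / p - 1 / 2) * q))
    (hρ₁ : ρ₁ = C₁ - C₂ * κ)
    (hρ₂ : ρ₂ = C₁ - C₂ * 2 ^ (q / p - 1) * κ)
    (η₁ η₂ : ℝ) (b : Fin L → ℝ) (X Xhat : Matrix (Fin m) (Fin n) ℝ) :
    -- (1) matrices `X` of rank at most `r`
    (1 < k → C₂ / C₁ < k ^ ((1 / p - 1 / 2) * q) → X.rank ≤ r →
      -- noise in both sets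
      (b - A X ∈ MatrixRecovery.lqBall L q η₁ ∩ MatrixRecovery.dantzigBall A η₂ →
        MatrixRecovery.IsSchattenMinimizer A p b
          (MatrixRecovery.lqBall L q η₁ ∩ MatrixRecovery.dantzigBall A η₂) Xhat →
        MatrixRecovery.schattenNorm 2 (Xhat - X) ^ q ≤
          (κ + 1) * (1 / (ρ₁ * (L : ℝ) ^ q)) *
            min (2 / (L : ℝ) ^ (1 - 2 * q) * η₁ ^ q)
              (2 ^ (q / p + q) / ρ₁ * (r : ℝ) ^ ((1 / p - 1 / 2) * q) * η₂ ^ q)) ∧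
      -- `ℓ_q`-bounded noise
      (b - A X ∈ MatrixRecovery.lqBall L q η₁ →
        MatrixRecovery.IsSchattenMinimizer A p b (MatrixRecovery.lqBall L q η₁) Xhat →
        MatrixRecovery.schattenNorm 2 (Xhat - X) ^ q ≤
          2 / (ρ₁ * (L : ℝ) ^ (1 - q)) * (κ + 1) * η₁ ^ q) ∧
      -- Dantzig selector noise
      (b - A X ∈ MatrixRecovery.dantzigBall A η₂ →
        MatrixRecovery.IsSchattenMinimizer A p b (MatrixRecovery.dantzigBall A η₂) Xhat →
        MatrixRecovery.schattenNorm 2 (Xhat - X) ^ q ≤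
          2 ^ (q / p + q) * (r : ℝ) ^ ((1 / p - 1 / 2) * q) / ((L : ℝ) ^ q * ρ₁ ^ 2) *
            (κ + 1) * η₂ ^ q)) ∧
    -- (2) arbitrary matrices `X`, with best rank-`r` approximation `Xr`
    ((2 : ℝ) ^ (2 * (q - p) / (q * (2 - p))) < k →
      C₂ / C₁ < 2 ^ (1 - q / p) * k ^ ((1 / p - 1 / 2) * q) →
      ∀ Xr : Matrix (Fin m) (Fin n) ℝ, MatrixRecovery.IsBestRankApprox r X Xr →
      -- noise in both sets
      (b - A X ∈ MatrixRecovery.lqBall L q η₁ ∩ MatrixRecovery.dantzigBall A η₂ →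
        MatrixRecovery.IsSchattenMinimizer A p b
          (MatrixRecovery.lqBall L q η₁ ∩ MatrixRecovery.dantzigBall A η₂) Xhat →
        MatrixRecovery.schattenNorm 2 (Xhat - X) ^ q ≤
          min
            ((C₂ * 2 ^ (2 * q / p - 1) / ρ₂ * κ + 1) * (2 ^ (2 * q / p - 1) * κ + 1) *
                (MatrixRecovery.schattenNorm p (X - Xr) / (r : ℝ) ^ (1 / p - 1 / 2)) ^ q +
              2 / (ρ₂ * (L : ℝ) ^ (1 - q)) * (2 ^ (q / p - 1) * κ + 1) * η₁ ^ q)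
            ((C₂ * 2 ^ (2 * q / p) / ρ₂ * κ + 3 / 2) * (2 ^ (2 * q / p - 1) * κ + 1) *
                (MatrixRecovery.schattenNorm p (X - Xr) / (r : ℝ) ^ (1 / p - 1 / 2)) ^ q +
              2 ^ (2 * q / p + q + 1) * (r : ℝ) ^ ((1 / p - 1 / 2) * q) /
                  ((L : ℝ) ^ q * ρ₂ ^ 2) * (2 ^ (q / p - 1) * κ + 1) * η₂ ^ q)) ∧
      -- `ℓ_q`-bounded noise
      (b - A X ∈ MatrixRecovery.lqBall L q η₁ →
        MatrixRecovery.IsSchattenMinimizer A p b (MatrixRecovery.lqBall L q η₁) Xhat →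
        MatrixRecovery.schattenNorm 2 (Xhat - X) ^ q ≤
          (C₂ * 2 ^ (2 * q / p - 1) / ρ₂ * κ + 1) * (2 ^ (2 * q / p - 1) * κ + 1) *
              (MatrixRecovery.schattenNorm p (X - Xr) / (r : ℝ) ^ (1 / p - 1 / 2)) ^ q +
            2 / (ρ₂ * (L : ℝ) ^ (1 - q)) * (2 ^ (q / p - 1) * κ + 1) * η₁ ^ q) ∧
      -- Dantzig selector noise
      (b - A X ∈ MatrixRecovery.dantzigBall A η₂ →
        MatrixRecovery.IsSchattenMinimizer A p b (MatrixRecovery.dantzigBall A η₂) Xhat →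
        MatrixRecovery.schattenNorm 2 (Xhat - X) ^ q ≤
          (C₂ * 2 ^ (2 * q / p) / ρ₂ * κ + 3 / 2) * (2 ^ (2 * q / p - 1) * κ + 1) *
              (MatrixRecovery.schattenNorm p (X - Xr) / (r : ℝ) ^ (1 / p - 1 / 2)) ^ q +
            2 ^ (2 * q / p + q + 1) * (r : ℝ) ^ ((1 / p - 1 / 2) * q) /
                ((L : ℝ) ^ q * ρ₂ ^ 2) * (2 ^ (q / p - 1) * κ + 1) * η₂ ^ q)) := by
  have hq0 : 0 < q := hp.trans_le hpq
  have hr' : (0 : ℝ) < r := Nat.cast_pos.2 hr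
  set θ := (1 / p - 1 / 2) * q with hθ
  set R := (r : ℝ) ^ θ with hR
  have hR0 : 0 < R := Real.rpow_pos_of_pos hr' _
  have hs_of_k : 0 < k → 0 < s := fun hk => by
    have : (0 : ℝ) < s := by
      rw [← hks]
      positivity
    exact_mod_cast this
  have hκ_of_k : 0 < k → 0 < κ ∧ κ * k ^ θ = 1 := fun hk => by
    rw [hκ, ← Real.mul_rpow (by positivity) hk.le, one_div_mul_cancel hk.ne', Real.one_rpow]
    exact ⟨by positivity, rfl⟩
  refine ⟨fun hk hC hrank => ?_, fun hk hC Xr hXr => ?_⟩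
  · have hk0 : 0 < k := by linarith
    have hs := hs_of_k hk0
    obtain ⟨hκ0, hκk⟩ := hκ_of_k hk0
    -- As κ is the inverse of k^θ, the bound on C₂/C₁ says exactly C₂κ < C₁.
    have hρ : 0 < ρ₁ := by
      rw [div_lt_iff₀ hC₁] at hC
      have := mul_lt_mul_of_pos_right hC hκ0
      rw [hρ₁, sub_pos]
      calc C₂ * κ < k ^ θ * C₁ * κ := this
        _ = κ * k ^ θ * C₁ := by ring
        _ = C₁ := by rw [hκk, one_mul]
    -- Nonnegativity of C₂ and L > 0 can fail only if all singular values of all matrices vanish;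
    -- then the left side is 0 and only the sign of the right side matters.
    rcases hA.le_and_pos_or_singVal_eq_zero (by omega) hq0 hC₁ with ⟨hC₁₂, hL⟩ | hdeg
    · have hL' : (0 : ℝ) < L := Nat.cast_pos.2 hL
      have hC₂ : 0 ≤ C₂ := by linarith
      have hlq : b - A X ∈ MatrixRecovery.lqBall L q η₁ →
          b - A Xhat ∈ MatrixRecovery.lqBall L q η₁ →
          MatrixRecovery.schattenNorm p Xhat ^ p ≤ MatrixRecovery.schattenNorm p X ^ p →
          MatrixRecovery.schattenNorm 2 (Xhat - X) ^ q ≤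
            2 / (ρ₁ * (L : ℝ) ^ (1 - q)) * (κ + 1) * η₁ ^ q := by
        intro hX hXhat hmin
        obtain ⟨a, S, ha, h1, h2, h3, -⟩ := MatrixRecovery.exists_estimates_of_rank_le hr hs hks
          hp hpq hq hA hκ hrank hmin
        refine (MatrixRecovery.error_le_of_le hκ0.le hC₂ hρ₁ hρ h3 h1 h2
          (MatrixRecovery.lqNorm_rpow_div_le_of_mem_lqBall hq0 hq hL hX hXhat)).trans (le_of_eq ?_)
        field_simp
      have hds : b - A X ∈ MatrixRecovery.dantzigBall A η₂ →
          b - A Xhat ∈ MatrixRecovery.dantzigBall A η₂ →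
          MatrixRecovery.schattenNorm p Xhat ^ p ≤ MatrixRecovery.schattenNorm p X ^ p →
          MatrixRecovery.schattenNorm 2 (Xhat - X) ^ q ≤
            2 ^ (q / p + q) * R / ((L : ℝ) ^ q * ρ₁ ^ 2) * (κ + 1) * η₂ ^ q := by
        intro hX hXhat hmin
        have hη := MatrixRecovery.nonneg_of_mem_dantzigBall hX
        obtain ⟨a, S, ha, h1, h2, h3, h4⟩ := MatrixRecovery.exists_estimates_of_rank_le hr hs hks
          hp hpq hq hA hκ hrank hmin
        rw [← hθ, ← hR] at h4
        have h5 := (MatrixRecovery.lqNorm_rpow_div_sq_le_of_mem_dantzigBall hq0 hq hL hX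
          hXhat).trans (mul_le_mul_of_nonneg_left h4 (by positivity))
        rw [← mul_assoc] at h5
        refine (MatrixRecovery.error_le_of_sq_le hκ0.le hC₂ ha (by positivity) hρ₁ hρ h3 h1 h2
          h5).trans (le_of_eq ?_)
        rw [Real.rpow_add two_pos]
        field_simp
      refine ⟨fun hX hXhat => ?_, fun hX hXhat => hlq hX hXhat.1 (hXhat.2 X hX),
        fun hX hXhat => hds hX hXhat.1 (hXhat.2 X hX)⟩
      -- Minimality enters only through comparison with X, so both single-noise bounds apply to the
      -- intersection.
      have hmin := hXhat.2 X hX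
      rw [mul_min_of_nonneg _ _ (by positivity)]
      refine le_min ((hlq hX.1 hXhat.1.1 hmin).trans (le_of_eq ?_))
        ((hds hX.2 hXhat.1.2 hmin).trans (le_of_eq ?_))
      · rw [show (1 : ℝ) - q = q + (1 - 2 * q) by ring, Real.rpow_add hL']
        field_simp
      · field_simp
    · rw [MatrixRecovery.schattenNorm_eq_zero_of_singVal_eq_zero two_pos (hdeg (Xhat - X)),
        Real.zero_rpow hq0.ne']
      refine ⟨fun hX _ => ?_, fun hX _ => ?_, fun hX _ => ?_⟩
      · have hη₁ := MatrixRecovery.nonneg_of_mem_lqBall hX.1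
        have hη₂ := MatrixRecovery.nonneg_of_mem_dantzigBall hX.2
        exact mul_nonneg (by positivity) (le_min (by positivity) (by positivity))
      · have hη₁ := MatrixRecovery.nonneg_of_mem_lqBall hX
        positivity
      · have hη₂ := MatrixRecovery.nonneg_of_mem_dantzigBall hX
        positivity
  · have hk0 : 0 < k := (by positivity : (0 : ℝ) < 2 ^ (2 * (q - p) / (q * (2 - p)))).trans hk
    have hs := hs_of_k hk0
    obtain ⟨hκ0, hκk⟩ := hκ_of_k hk0
    have hρ : 0 < ρ₂ := by
      rw [div_lt_iff₀ hC₁] at hC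
      have h1 := mul_lt_mul_of_pos_right hC (by positivity : 0 < (2 : ℝ) ^ (q / p - 1) * κ)
      have h2 : (2 : ℝ) ^ (1 - q / p) * 2 ^ (q / p - 1) = 1 := by
        rw [← Real.rpow_add two_pos]
        simp
      rw [hρ₂, sub_pos]
      calc C₂ * 2 ^ (q / p - 1) * κ = C₂ * (2 ^ (q / p - 1) * κ) := by ring
        _ < 2 ^ (1 - q / p) * k ^ θ * C₁ * (2 ^ (q / p - 1) * κ) := h1
        _ = 2 ^ (1 - q / p) * 2 ^ (q / p - 1) * (κ * k ^ θ) * C₁ := by ring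
        _ = C₁ := by rw [h2, hκk, one_mul, one_mul]
    have hqp : 1 ≤ q / p := by rwa [le_div_iff₀ hp, one_mul]
    set τ := (MatrixRecovery.schattenNorm p (X - Xr) / (r : ℝ) ^ (1 / p - 1 / 2)) ^ q with hτ
    have hτ0 : 0 ≤ τ := Real.rpow_nonneg
      (div_nonneg (MatrixRecovery.schattenNorm_nonneg _ _) (by positivity)) _
    have hα0 : 0 ≤ (2 : ℝ) ^ (q / p - 1) * κ := by positivity
    -- This is q/p ≤ 2q/p - 1, that is, p ≤ q.
    have hαβ : 2 * ((2 : ℝ) ^ (q / p - 1) * κ) ≤ 2 ^ (2 * q / p - 1) * κ := by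
      rw [← mul_assoc]
      refine mul_le_mul_of_nonneg_right ?_ hκ0.le
      rw [← Real.rpow_one_add' zero_le_two (by linarith)]
      refine Real.rpow_le_rpow_of_exponent_le one_le_two ?_
      have : 2 * q / p = q / p + q / p := by ring
      linarith
    have hρ₂' : ρ₂ = C₁ - C₂ * (2 ^ (q / p - 1) * κ) := by rw [hρ₂, mul_assoc]
    rcases hA.le_and_pos_or_singVal_eq_zero (by omega) hq0 hC₁ with ⟨hC₁₂, hL⟩ | hdeg
    · have hL' : (0 : ℝ) < L := Nat.cast_pos.2 hL
      have hC₂ : 0 ≤ C₂ := by linarith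
      have hlq : b - A X ∈ MatrixRecovery.lqBall L q η₁ →
          b - A Xhat ∈ MatrixRecovery.lqBall L q η₁ →
          MatrixRecovery.schattenNorm p Xhat ^ p ≤ MatrixRecovery.schattenNorm p X ^ p →
          MatrixRecovery.schattenNorm 2 (Xhat - X) ^ q ≤
            (C₂ * 2 ^ (2 * q / p - 1) / ρ₂ * κ + 1) * (2 ^ (2 * q / p - 1) * κ + 1) * τ +
              2 / (ρ₂ * (L : ℝ) ^ (1 - q)) * (2 ^ (q / p - 1) * κ + 1) * η₁ ^ q := by
        intro hX hXhat hmin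
        obtain ⟨a, S, ha, h1, h2, h3, -⟩ := MatrixRecovery.exists_estimates hr hs hks
          hp hpq hq hA hκ hXr.1 hmin
        refine (MatrixRecovery.error_le_of_le_of_tail hα0 (by linarith) hτ0 hC₂ hρ₂' hρ h3 h1 h2
          (MatrixRecovery.lqNorm_rpow_div_le_of_mem_lqBall hq0 hq hL hX hXhat)).trans (le_of_eq ?_)
        congr 1
        · ring
        · field_simp
      have hds : b - A X ∈ MatrixRecovery.dantzigBall A η₂ →
          b - A Xhat ∈ MatrixRecovery.dantzigBall A η₂ →
          MatrixRecovery.schattenNorm p Xhat ^ p ≤ MatrixRecovery.schattenNorm p X ^ p →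
          MatrixRecovery.schattenNorm 2 (Xhat - X) ^ q ≤
            (C₂ * 2 ^ (2 * q / p) / ρ₂ * κ + 3 / 2) * (2 ^ (2 * q / p - 1) * κ + 1) * τ +
              2 ^ (2 * q / p + q + 1) * R / ((L : ℝ) ^ q * ρ₂ ^ 2) *
                (2 ^ (q / p - 1) * κ + 1) * η₂ ^ q := by
        intro hX hXhat hmin
        have hη := MatrixRecovery.nonneg_of_mem_dantzigBall hX
        obtain ⟨a, S, ha, h1, h2, h3, h4⟩ := MatrixRecovery.exists_estimates hr hs hks
          hp hpq hq hA hκ hXr.1 hmin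
        rw [← hθ, ← hR] at h4
        have h5 := (MatrixRecovery.lqNorm_rpow_div_sq_le_of_mem_dantzigBall hq0 hq hL hX
          hXhat).trans (mul_le_mul_of_nonneg_left h4 (by positivity))
        rw [← mul_assoc] at h5
        refine (MatrixRecovery.error_le_of_sq_le_of_tail hα0 hαβ hτ0 ha hC₂ (by positivity) hρ₂' hρ
          h3 h1 h2 h5).trans (le_of_eq ?_)
        have e1 : (2 : ℝ) ^ (2 * q / p) = 2 * 2 ^ (2 * q / p - 1) := by
          rw [Real.rpow_sub_one two_ne_zero]
          ring
        congr 1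
        · rw [e1]
          ring
        · rw [Real.rpow_add_one two_ne_zero, Real.rpow_add two_pos, e1]
          field_simp
          ring
      refine ⟨fun hX hXhat => ?_, fun hX hXhat => hlq hX hXhat.1 (hXhat.2 X hX),
        fun hX hXhat => hds hX hXhat.1 (hXhat.2 X hX)⟩
      have hmin := hXhat.2 X hX
      exact le_min (hlq hX.1 hXhat.1.1 hmin) (hds hX.2 hXhat.1.2 hmin)
    · have hτ' : τ = 0 := by
        rw [hτ, MatrixRecovery.schattenNorm_eq_zero_of_singVal_eq_zero hp (hdeg (X - Xr)),
          zero_div, Real.zero_rpow hq0.ne']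
      rw [MatrixRecovery.schattenNorm_eq_zero_of_singVal_eq_zero two_pos (hdeg (Xhat - X)),
        Real.zero_rpow hq0.ne', hτ']
      simp only [mul_zero, zero_add]
      refine ⟨fun hX _ => ?_, fun hX _ => ?_, fun hX _ => ?_⟩
      · have hη₁ := MatrixRecovery.nonneg_of_mem_lqBall hX.1
        have hη₂ := MatrixRecovery.nonneg_of_mem_dantzigBall hX.2
        exact le_min (by positivity) (by positivity)
      · have hη₁ := MatrixRecovery.nonneg_of_mem_lqBall hX
        positivity
      · have hη₂ := MatrixRecovery.nonneg_of_mem_dantzigBall hX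
        positivity
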